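/- Let $\rho,\mu,\alpha_1,\beta,L,l_1,l_2,\eta>0$, $\gamma\in\mathbb R$ and $0<a<1$ be constants, and put $\alpha=\alpha_1+\gamma^2\beta$ and $m(\xi)=|\xi|^{(2a-1)/2}$ for $\xi\in\mathbb R$. All functions are complex-valued. Let $H^1_*(0,L)=\{u\in H^1(0,L): u(0)=0\}$ and $$\mathcal H=H^1_*(0,L)\times L^2(0,L)\times L^2(\mathbb R)\times H^1_*(0,L)\times L^2(0,L)\times L^2(\mathbb R),$$ with elements $U=(V,f,\phi_1,P,g,\phi_2)$ and the inner product $$\langle U,\tilde U\rangle_{\mathcal H}=\int_0^L\Big[\rho f\overline{\tilde f}+\mu g\overline{\tilde g}+\alpha_1V_x\overline{\tilde V_x}+\beta(\gamma V_x-P_x)\overline{(\gamma\tilde V_x-\tilde P_x)}\Big]dx+\frac{\sin(a\pi)}{\pi}\int_{\mathbb R}\big(l_1\phi_1\overline{\tilde\phi_1}+l_2\phi_2\overline{\tilde\phi_2}\big)d\xi .$$ Let $\mathcal A:\mathcal D(\mathcal A)\subset\mathcal H\to\mathcal H$ be the generator of the augmented piezoelectric beam system without thermal effects, $$\mathcal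 A U=\Big(f,\ \tfrac{\alpha}{\rho}V_{xx}-\tfrac{\gamma\beta}{\rho}P_{xx},\ -(\xi^2+\eta)\phi_1+f(L)m,\ g,\ -\tfrac{\gamma\beta}{\mu}V_{xx}+\tfrac{\beta}{\mu}P_{xx},\ -(\xi^2+\eta)\phi_2+g(L)m\Big),$$ where $\mathcal D(\mathcal A)$ consists of all $U\in\mathcal H$ such that $V,P\in H^2(0,L)\cap H^1_*(0,L)$; $f,g\in H^1_*(0,L)$; $|\xi|\phi_1,\ |\xi|\phi_2\in L^2(\mathbb R)$; $-(\xi^2+\eta)\phi_1+f(L)m,\ -(\xi^2+\eta)\phi_2+g(L)m\in L^2(\mathbb R)$; and $$\alpha V_x(L)-\gamma\beta P_x(L)=-l_1\frac{\sin(a\pi)}{\pi}\int_{\mathbb R}m(\xi)\phi_1(\xi)\,d\xi,\qquad \beta P_x(L)-\gamma\beta V_x(L)=-l_2\frac{\sin(a\pi)}{\pi}\int_{\mathbb R}m(\xi)\phi_2(\xi)\,d\xi .$$ Let $\rho(\mathcal A)$ be the resolvent set of $\mathcal A$, that is, the set of all $z\in\mathbb C$ for which $zI-\mathcal A:\mathcal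 D(\mathcal A)\to\mathcal H$ is bijective with bounded inverse. Then $i\mathbb R\subset\rho(\mathcal A)$. -/

import Mathlib

namespace Piezo
noncomputable section
open MeasureTheory Set
open scoped ContDiff

/-- `L²(0, L)`, complex-valued. -/
abbrev L2I (L : ℝ) : Type := Lp ℂ 2 (volume.restrict (Ioo 0 L))

/-- `L²(ℝ)`, complex-valued. -/
abbrev L2R : Type := Lp ℂ 2 (volume : Measure ℝ)

/-- `φ` is a test function on `(0, L)`: smooth, with compact support contained in `(0, L)`. -/
structure IsTest (L : ℝ) (φ : ℝ → ℝ) : Prop where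
  smooth : ContDiff ℝ ∞ φ
  compact : HasCompactSupport φ
  supp : tsupport φ ⊆ Ioo 0 L

/-- `u'` is the weak derivative of `u` on `(0, L)`. -/
def HasWeakDeriv {L : ℝ} (u u' : L2I L) : Prop :=
  ∀ φ : ℝ → ℝ, IsTest L φ →
    ∫ x in Ioo 0 L, deriv φ x • u x = -∫ x in Ioo 0 L, φ x • u' x

variable {L : ℝ}

theorem integrableOn_L2I (u : L2I L) : IntegrableOn u (Ioo 0 L) :=
  (Lp.memLp u).integrable (by norm_num)

theorem integrable_smul_L2I (u : L2I L) {ψ : ℝ → ℝ} (hψ : Continuous ψ)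
    (hc : HasCompactSupport ψ) : Integrable (fun x => ψ x • u x) (volume.restrict (Ioo 0 L)) := by
  obtain ⟨C, hC⟩ := hc.exists_bound_of_continuous hψ
  exact (integrableOn_L2I u).integrable.bdd_smul C hψ.aestronglyMeasurable
    (Filter.Eventually.of_forall hC)

/-- The primitive `∫₀ˣ u'` of `u'` that vanishes at `0`. -/
def prim (u' : L2I L) (x : ℝ) : ℂ := ∫ t in Ioo 0 L ∩ Iic x, u' t

theorem continuous_prim (u' : L2I L) : Continuous (prim u') := by
  have h : Integrable ((Ioo 0 L).indicator u') := 
    (integrableOn_L2I u').integrable_indicator measurableSet_Ioo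
  have : prim u' = fun x => (∫ t in Iic 0, (Ioo 0 L).indicator u' t) + 
      ∫ t in (0:ℝ)..x, (Ioo 0 L).indicator u' t := by
    ext x
    rw [add_comm, ← sub_eq_iff_eq_add, intervalIntegral.integral_Iic_sub_Iic h.integrableOn h.integrableOn |>.symm]
    simp only [prim, setIntegral_indicator measurableSet_Ioo]
    rw [inter_comm]
  rw [this]
  exact continuous_const.add (intervalIntegral.continuous_primitive (fun _ _ => h.intervalIntegrable) 0)

theorem integrable_smul_prim (u' : L2I L) {ψ : ℝ → ℝ} (hψ : Continuous ψ)
    (hc : HasCompactSupport ψ) :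
    Integrable (fun x => ψ x • prim u' x) (volume.restrict (Ioo 0 L)) :=
  ((hψ.smul (continuous_prim u')).integrable_of_hasCompactSupport hc.smul_right).restrict

theorem integral_deriv_smul_prim (u' : L2I L) {φ : ℝ → ℝ} (hφ : IsTest L φ) :
    ∫ x in Ioo 0 L, deriv φ x • prim u' x = -∫ x in Ioo 0 L, φ x • u' x := by
  have hd : Continuous (deriv φ) := hφ.smooth.continuous_deriv (by norm_num)
  have hdc : HasCompactSupport (deriv φ) := hφ.compact.deriv
  have hdi : Integrable (deriv φ) (volume.restrict (Ioo 0 L)) :=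
    (hd.integrable_of_hasCompactSupport hdc).restrict
  have h1 : ∀ x, deriv φ x • prim u' x =
      ∫ t in Ioo 0 L, (Iic x).indicator (fun t => deriv φ x • u' t) t := by
    intro x
    rw [setIntegral_indicator measurableSet_Iic, integral_smul, prim]
  have hint : Integrable (Function.uncurry fun x t =>
      (Iic x).indicator (fun t => deriv φ x • u' t) t)
      ((volume.restrict (Ioo 0 L)).prod (volume.restrict (Ioo 0 L))) := by
    have h2 := hdi.smul_prod (integrableOn_L2I u').integrable
    have hm : MeasurableSet {z : ℝ × ℝ | z.2 ≤ z.1} :=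
      measurableSet_le measurable_snd measurable_fst
    refine (h2.indicator hm).congr (Filter.Eventually.of_forall ?_)
    rintro ⟨x, t⟩
    simp [indicator, Function.uncurry]
  simp_rw [h1]
  rw [integral_integral_swap hint, ← integral_neg]
  refine setIntegral_congr_fun measurableSet_Ioo fun t ht => ?_
  have h3 : ∀ x, (Iic x).indicator (fun t => deriv φ x • u' t) t =
      ((Ici t).indicator (deriv φ) x) • u' t := by
    intro x; by_cases h : t ≤ x <;> simp [indicator, h]
  simp_rw [h3]
  rw [integral_smul_const, setIntegral_indicator measurableSet_Ici, ← neg_smul]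
  congr 1
  have h4 : Ioo 0 L ∩ Ici t = Ico t L := by
    ext x; simp only [mem_inter_iff, mem_Ioo, mem_Ici, mem_Ico]
    exact ⟨fun h => ⟨h.2, h.1.2⟩, fun h => ⟨⟨ht.1.trans_le h.1, h.2⟩, h.1⟩⟩
  rw [h4, integral_Ico_eq_integral_Ioo, ← integral_Ioc_eq_integral_Ioo,
    ← intervalIntegral.integral_of_le ht.2.le,
    intervalIntegral.integral_deriv_eq_sub
      (fun x _ => (hφ.smooth.differentiable (by norm_num)) x) (hd.intervalIntegrable _ _)]
  have : φ L = 0 := image_eq_zero_of_notMem_tsupport fun h => (lt_irrefl _ (hφ.supp h).2)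
  simp [this]

theorem exists_test_integral_one (hL : 0 < L) :
    ∃ χ : ℝ → ℝ, IsTest L χ ∧ ∫ x, χ x = 1 := by
  let b : ContDiffBump (L / 2 : ℝ) := ⟨L / 8, L / 4, by positivity, by linarith⟩
  refine ⟨b.normed volume, ⟨b.contDiff_normed (μ := volume), b.hasCompactSupport_normed (μ := volume), ?_⟩, b.integral_normed (μ := volume)⟩
  rw [b.tsupport_normed_eq (μ := volume), Real.closedBall_eq_Icc]
  intro x hx
  have h1 : L / 2 - L / 4 ≤ x := hx.1
  have h2 : x ≤ L / 2 + L / 4 := hx.2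
  constructor <;> linarith

theorem exists_test_primitive {θ : ℝ → ℝ} (hθ : IsTest L θ) (h0 : ∫ x, θ x = 0) :
    ∃ ψ : ℝ → ℝ, IsTest L ψ ∧ deriv ψ = θ := by
  have hc := hθ.smooth.continuous
  have hder : ∀ x, HasDerivAt (fun x => ∫ t in (0:ℝ)..x, θ t) (θ x) x := fun x =>
    intervalIntegral.integral_hasDerivAt_right (hc.intervalIntegrable _ _)
      (hc.stronglyMeasurableAtFilter _ _) hc.continuousAt
  have hde : deriv (fun x => ∫ t in (0:ℝ)..x, θ t) = θ := funext fun x => (hder x).deriv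
  rcases (tsupport θ).eq_empty_or_nonempty with he | hne
  · have hz : θ = 0 := by rwa [tsupport_eq_empty_iff] at he
    refine ⟨0, ⟨contDiff_const, HasCompactSupport.zero, by simp⟩, by rw [hz]; ext; simp⟩
  have hcomp : IsCompact (tsupport θ) := hθ.compact
  obtain ⟨m, hm, hm'⟩ := hcomp.exists_isLeast hne
  obtain ⟨M, hM, hM'⟩ := hcomp.exists_isGreatest hne
  have hzero : ∀ x, x ∉ Icc m M → θ x = 0 := fun x hx =>
    image_eq_zero_of_notMem_tsupport fun h => hx ⟨hm' h, hM' h⟩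
  have hm0 := (hθ.supp hm).1
  have hML := (hθ.supp hM).2
  have hsupp : ∀ x, x ∉ Icc m M → ∫ t in (0:ℝ)..x, θ t = 0 := by
    intro x hx
    rcases lt_or_ge x m with h | h
    · apply intervalIntegral.integral_zero_ae
      refine Filter.Eventually.of_forall fun t ht => hzero t fun h' => ?_
      rcases mem_uIoc.1 ht with h2 | h2 <;> linarith [h'.1, h2.2]
    · have hMx : M < x := by by_contra! h'; exact hx ⟨h, h'⟩
      refine (intervalIntegral.integral_eq_integral_of_support_subset fun t ht => ?_).trans h0
      have : t ∈ Icc m M := by by_contra h'; exact ht (hzero t h')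
      exact ⟨hm0.trans_le this.1, this.2.trans hMx.le⟩
  have hts : tsupport (fun x => ∫ t in (0:ℝ)..x, θ t) ⊆ Icc m M :=
    closure_minimal (fun x hx => by by_contra h; exact hx (hsupp x h)) isClosed_Icc
  refine ⟨fun x => ∫ t in (0:ℝ)..x, θ t, ⟨?_, ?_, ?_⟩, hde⟩
  · rw [contDiff_infty_iff_deriv, hde]
    exact ⟨fun x => (hder x).differentiableAt, hθ.smooth⟩
  · exact isCompact_Icc.of_isClosed_subset (isClosed_tsupport _) hts
  · exact hts.trans fun x hx => ⟨hm0.trans_le hx.1, hx.2.trans_lt hML⟩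

theorem HasWeakDeriv.ae_eq_prim (hL : 0 < L) {u u' : L2I L} (h : HasWeakDeriv u u') :
    ∃ c : ℂ, u =ᵐ[volume.restrict (Ioo 0 L)] fun x => c + prim u' x := by
  obtain ⟨χ, hχ, hχ1⟩ := exists_test_integral_one hL
  set μ := volume.restrict (Ioo 0 L) with hμ
  have hset : ∀ {φ : ℝ → ℝ}, IsTest L φ → ∫ x in Ioo 0 L, φ x = ∫ x, φ x := fun hφ =>
    setIntegral_eq_integral_of_forall_compl_eq_zero fun x hx =>
      image_eq_zero_of_notMem_tsupport fun h' => hx (hφ.supp h')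
  have hiφ : ∀ {φ : ℝ → ℝ}, IsTest L φ → Integrable φ μ := fun hφ =>
    (hφ.smooth.continuous.integrable_of_hasCompactSupport hφ.compact).restrict
  let v : ℝ → ℂ := fun x => u x - prim u' x
  have hv : ∀ {φ : ℝ → ℝ}, IsTest L φ → Integrable (fun x => φ x • v x) μ := by
    intro φ hφ
    simp only [v, smul_sub]
    exact (integrable_smul_L2I u hφ.smooth.continuous hφ.compact).sub
      (integrable_smul_prim u' hφ.smooth.continuous hφ.compact)
  have hvd : ∀ {φ : ℝ → ℝ}, IsTest L φ → ∫ x, deriv φ x • v x ∂μ = 0 := by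
    intro φ hφ
    have hd : Continuous (deriv φ) := hφ.smooth.continuous_deriv (by norm_num)
    simp only [v, smul_sub]
    rw [integral_sub (integrable_smul_L2I u hd hφ.compact.deriv)
      (integrable_smul_prim u' hd hφ.compact.deriv), h φ hφ, integral_deriv_smul_prim u' hφ, sub_self]
  let c : ℂ := ∫ x, χ x • v x ∂μ
  refine ⟨c, ?_⟩
  have key : ∀ φ : ℝ → ℝ, ContDiff ℝ ∞ φ → HasCompactSupport φ → tsupport φ ⊆ Ioo 0 L →
      ∫ x, φ x • (u x - (c + prim u' x)) ∂μ = 0 := by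
    intro φ h1 h2 h3
    have hφ : IsTest L φ := ⟨h1, h2, h3⟩
    set m := ∫ x, φ x with hm
    have hθ : IsTest L (fun x => φ x - m * χ x) := by
      refine ⟨h1.sub (contDiff_const.mul hχ.smooth), ?_, ?_⟩
      · exact h2.sub (hχ.compact.mul_left)
      · refine (tsupport_sub _ _).trans (union_subset h3 ?_)
        exact (tsupport_mul_subset_right (f := fun _ => m)).trans hχ.supp
    have h0 : ∫ x, (φ x - m * χ x) = 0 := by
      rw [integral_sub (h1.continuous.integrable_of_hasCompactSupport h2)
        ((hχ.smooth.continuous.integrable_of_hasCompactSupport hχ.compact).const_mul _),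
        integral_const_mul, hχ1, ← hm]
      ring
    obtain ⟨ψ, hψ, hψd⟩ := exists_test_primitive hθ h0
    have h4 := hvd hψ
    rw [hψd] at h4
    simp only [sub_smul, mul_smul] at h4
    rw [integral_sub (f := fun x => φ x • v x) (g := fun x => m • χ x • v x) (hv hφ)
      ((hv hχ).smul m), integral_smul] at h4
    have h5 : ∀ x, φ x • (u x - (c + prim u' x)) = φ x • v x - φ x • c := by
      intro x; simp only [v, ← smul_sub]; congr 1; ring
    simp_rw [h5]
    rw [integral_sub (hv hφ) ((hiφ hφ).smul_const c), integral_smul_const, hset hφ]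
    exact h4
  have hae : ∀ᵐ x, x ∈ Ioo 0 L → u x - (c + prim u' x) = 0 := by
    refine isOpen_Ioo.ae_eq_zero_of_integral_contDiff_smul_eq_zero ?_ ?_
    · refine IntegrableOn.locallyIntegrableOn ?_
      refine (integrableOn_L2I u).sub ?_
      exact ((continuous_const.add (continuous_prim u')).integrableOn_Icc (a := 0) (b := L)).mono_set
        Ioo_subset_Icc_self
    · intro g h1 h2 h3
      rw [← key g h1 h2 h3]
      refine (setIntegral_eq_integral_of_forall_compl_eq_zero fun x hx => ?_).symm
      rw [image_eq_zero_of_notMem_tsupport fun h' => hx (h3 h'), zero_smul]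
  filter_upwards [(ae_restrict_iff' measurableSet_Ioo).2 hae] with x hx
  exact sub_eq_zero.1 hx

theorem HasWeakDeriv.add {u u' v v' : L2I L} (hu : HasWeakDeriv u u') (hv : HasWeakDeriv v v') :
    HasWeakDeriv (u + v) (u' + v') := by
  intro φ hφ
  have hd : Continuous (deriv φ) := hφ.smooth.continuous_deriv (by norm_num)
  have h1 : ∫ x in Ioo 0 L, deriv φ x • (u + v : L2I L) x =
      ∫ x in Ioo 0 L, (deriv φ x • u x + deriv φ x • v x) :=
    integral_congr_ae (by filter_upwards [Lp.coeFn_add u v] with x hx; rw [hx, Pi.add_apply, smul_add])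
  have h2 : ∫ x in Ioo 0 L, φ x • (u' + v' : L2I L) x =
      ∫ x in Ioo 0 L, (φ x • u' x + φ x • v' x) :=
    integral_congr_ae (by filter_upwards [Lp.coeFn_add u' v'] with x hx; rw [hx, Pi.add_apply, smul_add])
  rw [h1, h2, integral_add (integrable_smul_L2I u hd hφ.compact.deriv)
    (integrable_smul_L2I v hd hφ.compact.deriv),
    integral_add (integrable_smul_L2I u' hφ.smooth.continuous hφ.compact)
    (integrable_smul_L2I v' hφ.smooth.continuous hφ.compact), hu φ hφ, hv φ hφ]
  ring

theorem HasWeakDeriv.smul {u u' : L2I L} (z : ℂ) (hu : HasWeakDeriv u u') :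
    HasWeakDeriv (z • u) (z • u') := by
  intro φ hφ
  have h1 : ∫ x in Ioo 0 L, deriv φ x • (z • u : L2I L) x =
      ∫ x in Ioo 0 L, z • (deriv φ x • u x) :=
    integral_congr_ae (by
      filter_upwards [Lp.coeFn_smul z u] with x hx; simp only [hx, Pi.smul_apply, smul_comm z])
  have h2 : ∫ x in Ioo 0 L, φ x • (z • u' : L2I L) x = ∫ x in Ioo 0 L, z • (φ x • u' x) :=
    integral_congr_ae (by
      filter_upwards [Lp.coeFn_smul z u'] with x hx; simp only [hx, Pi.smul_apply, smul_comm z])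
  rw [h1, h2, integral_smul, integral_smul, hu φ hφ, smul_neg]

theorem hasWeakDeriv_zero : HasWeakDeriv (0 : L2I L) 0 := by
  have h := fun (ψ : ℝ → ℝ) => integral_congr_ae
    (μ := volume.restrict (Ioo 0 L)) (f := fun x => ψ x • (0 : L2I L) x) (g := fun _ => 0) (by
      filter_upwards [Lp.coeFn_zero ℂ 2 (volume.restrict (Ioo 0 L))] with x hx; rw [hx, Pi.zero_apply, smul_zero])
  intro φ _
  rw [h, h]; simp

theorem HasWeakDeriv.unique {u u' v' : L2I L} (hu : HasWeakDeriv u u') (hv : HasWeakDeriv u v') :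
    u' = v' := by
  have hae : ∀ᵐ x, x ∈ Ioo 0 L → u' x - v' x = 0 := by
    refine isOpen_Ioo.ae_eq_zero_of_integral_contDiff_smul_eq_zero
      ((integrableOn_L2I u').sub (integrableOn_L2I v')).locallyIntegrableOn ?_
    intro φ h1 h2 h3
    have hφ : IsTest L φ := ⟨h1, h2, h3⟩
    rw [← setIntegral_eq_integral_of_forall_compl_eq_zero (s := Ioo 0 L) fun x hx => by
      rw [image_eq_zero_of_notMem_tsupport fun h' => hx (h3 h'), zero_smul]]
    simp only [smul_sub]
    rw [integral_sub (integrable_smul_L2I u' h1.continuous h2)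
      (integrable_smul_L2I v' h1.continuous h2), sub_eq_zero, ← neg_inj, ← hu φ hφ, hv φ hφ]
  refine Lp.ext ?_
  filter_upwards [(ae_restrict_iff' measurableSet_Ioo).2 hae] with x hx
  exact sub_eq_zero.1 hx

/-- The Sobolev space `H¹(0, L)`. -/
def H1 (L : ℝ) : Submodule ℂ (L2I L) where
  carrier := {u | ∃ u', HasWeakDeriv u u'}
  add_mem' := fun ⟨u', hu⟩ ⟨v', hv⟩ => ⟨u' + v', hu.add hv⟩
  zero_mem' := ⟨0, hasWeakDeriv_zero⟩
  smul_mem' := fun z _ ⟨u', hu⟩ => ⟨z • u', hu.smul z⟩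

open Classical in
/-- The weak derivative `u_x` of `u ∈ H¹(0, L)` (and `0` if `u ∉ H¹(0, L)`). -/
def wd (u : L2I L) : L2I L := if h : ∃ u', HasWeakDeriv u u' then h.choose else 0

theorem wd_eq {u u' : L2I L} (h : HasWeakDeriv u u') : wd u = u' := by
  have h' : ∃ u', HasWeakDeriv u u' := ⟨u', h⟩
  rw [wd, dif_pos h']
  exact h'.choose_spec.unique h

theorem hasWeakDeriv_wd {u : L2I L} (hu : u ∈ H1 L) : HasWeakDeriv u (wd u) := by
  obtain ⟨u', h⟩ := hu
  rwa [wd_eq h]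

theorem wd_add {u v : L2I L} (hu : u ∈ H1 L) (hv : v ∈ H1 L) : wd (u + v) = wd u + wd v :=
  wd_eq ((hasWeakDeriv_wd hu).add (hasWeakDeriv_wd hv))

theorem wd_smul {u : L2I L} (z : ℂ) (hu : u ∈ H1 L) : wd (z • u) = z • wd u :=
  wd_eq ((hasWeakDeriv_wd hu).smul z)

theorem wd_zero : wd (0 : L2I L) = 0 := wd_eq hasWeakDeriv_zero

/-- The Sobolev space `H²(0, L)`. -/
def H2 (L : ℝ) : Submodule ℂ (L2I L) where
  carrier := {u | u ∈ H1 L ∧ wd u ∈ H1 L}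
  add_mem' := fun ⟨hu, hu'⟩ ⟨hv, hv'⟩ =>
    ⟨add_mem hu hv, by rw [wd_add hu hv]; exact add_mem hu' hv'⟩
  zero_mem' := ⟨zero_mem _, by rw [wd_zero]; exact zero_mem _⟩
  smul_mem' := fun z _ ⟨hu, hu'⟩ =>
    ⟨Submodule.smul_mem _ z hu, by rw [wd_smul z hu]; exact Submodule.smul_mem _ z hu'⟩

/-- `w` is continuous on `[0, L]` and equal to `u` almost everywhere on `(0, L)`. -/
def IsContRep (u : L2I L) (w : ℝ → ℂ) : Prop :=
  ContinuousOn w (Icc 0 L) ∧ u =ᵐ[volume.restrict (Ioo 0 L)] w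

open Classical in
/-- The value `u(x)`, `x ∈ [0, L]`, of the continuous representative of `u`
(and `0` if `u` has none; every element of `H¹(0, L)` has one, see `exists_isContRep`). -/
def val (u : L2I L) (x : ℝ) : ℂ := if h : ∃ w, IsContRep u w then h.choose x else 0

theorem val_eq (hL : 0 < L) {u : L2I L} {w : ℝ → ℂ} (h : IsContRep u w) {x : ℝ}
    (hx : x ∈ Icc 0 L) : val u x = w x := by
  have h' : ∃ w, IsContRep u w := ⟨w, h⟩
  rw [val, dif_pos h']
  have hs := h'.choose_spec
  refine Measure.eqOn_Icc_of_ae_eq (μ := volume) hL.ne ?_ hs.1 h.1 hx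
  rw [← restrict_Ioo_eq_restrict_Icc]
  exact hs.2.symm.trans h.2

theorem exists_isContRep (hL : 0 < L) {u : L2I L} (hu : u ∈ H1 L) : ∃ w, IsContRep u w := by
  obtain ⟨u', h⟩ := hu
  obtain ⟨c, hc⟩ := h.ae_eq_prim hL
  exact ⟨_, (continuous_const.add (continuous_prim u')).continuousOn, hc⟩

theorem isContRep_val (hL : 0 < L) {u : L2I L} (hu : u ∈ H1 L) : IsContRep u (val u) := by
  obtain ⟨w, hw⟩ := exists_isContRep hL hu
  have h : EqOn (val u) w (Icc 0 L) := fun x hx => val_eq hL hw hx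
  refine ⟨hw.1.congr h, ?_⟩
  filter_upwards [hw.2, ae_restrict_mem measurableSet_Ioo] with x hx hx'
  rw [hx, h (Ioo_subset_Icc_self hx')]

theorem val_add (hL : 0 < L) {u v : L2I L} (hu : u ∈ H1 L) (hv : v ∈ H1 L) {x : ℝ}
    (hx : x ∈ Icc 0 L) : val (u + v) x = val u x + val v x := by
  have h1 := isContRep_val hL hu
  have h2 := isContRep_val hL hv
  refine val_eq hL (w := fun x => val u x + val v x) ⟨h1.1.add h2.1, ?_⟩ hx
  filter_upwards [h1.2, h2.2, Lp.coeFn_add u v] with x e1 e2 e3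
  rw [e3, Pi.add_apply, e1, e2]

theorem val_smul (hL : 0 < L) {u : L2I L} (z : ℂ) (hu : u ∈ H1 L) {x : ℝ}
    (hx : x ∈ Icc 0 L) : val (z • u) x = z * val u x := by
  have h1 := isContRep_val hL hu
  refine val_eq hL (w := fun x => z * val u x) ⟨continuousOn_const.mul h1.1, ?_⟩ hx
  filter_upwards [h1.2, Lp.coeFn_smul z u] with x e1 e3
  rw [e3, Pi.smul_apply, e1, smul_eq_mul]

theorem val_zero (hL : 0 < L) {x : ℝ} (hx : x ∈ Icc 0 L) : val (0 : L2I L) x = 0 :=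
  val_eq hL (w := fun _ => 0) ⟨continuousOn_const, Lp.coeFn_zero _ _ _⟩ hx

/-- The physical and control parameters of the beam. -/
structure Params where
  /-- mass density -/
  ρ : ℝ
  /-- magnetic permeability -/
  μ : ℝ
  /-- elastic stiffness of the electrostatic model -/
  α₁ : ℝ
  /-- impermeability -/
  β : ℝ
  /-- piezoelectric coefficient -/
  γ : ℝ
  /-- length of the beam -/
  L : ℝ
  /-- first feedback gain -/
  l₁ : ℝ
  /-- second feedback gain -/
  l₂ : ℝ
  /-- exponential weight of the fractional derivative -/
  η : ℝ
  /-- order of the fractional derivative -/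
  a : ℝ
  hρ : 0 < ρ
  hμ : 0 < μ
  hα₁ : 0 < α₁
  hβ : 0 < β
  hL : 0 < L
  hl₁ : 0 < l₁
  hl₂ : 0 < l₂
  hη : 0 < η
  ha₀ : 0 < a
  ha₁ : a < 1

namespace Params

variable (p : Params)

/-- The elastic stiffness `α = α₁ + γ²β`. -/
def α : ℝ := p.α₁ + p.γ ^ 2 * p.β

/-- The constant `sin(aπ)/π`. -/
def κ : ℝ := Real.sin (p.a * Real.pi) / Real.pi

/-- The weight `|ξ|^((2a-1)/2)` (written `μ(ξ)`, not to be confused with the permeability). -/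
def wt (ξ : ℝ) : ℝ := |ξ| ^ ((2 * p.a - 1) / 2)

theorem κ_pos : 0 < p.κ :=
  div_pos (Real.sin_pos_of_pos_of_lt_pi (mul_pos p.ha₀ Real.pi_pos)
    (by nlinarith [p.ha₁, Real.pi_pos])) Real.pi_pos

theorem zero_mem_Icc : (0 : ℝ) ∈ Icc 0 p.L := ⟨le_rfl, p.hL.le⟩

theorem L_mem_Icc : p.L ∈ Icc 0 p.L := ⟨p.hL.le, le_rfl⟩

/-- `H¹_*(0, L)`: the functions in `H¹(0, L)` that vanish at `0`. -/
def H1star : Submodule ℂ (L2I p.L) where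
  carrier := {u | u ∈ H1 p.L ∧ val u 0 = 0}
  add_mem' := fun ⟨hu, hu0⟩ ⟨hv, hv0⟩ =>
    ⟨add_mem hu hv, by rw [val_add p.hL hu hv p.zero_mem_Icc, hu0, hv0, add_zero]⟩
  zero_mem' := ⟨zero_mem _, val_zero p.hL p.zero_mem_Icc⟩
  smul_mem' := fun z _ ⟨hu, hu0⟩ =>
    ⟨Submodule.smul_mem _ z hu, by rw [val_smul p.hL z hu p.zero_mem_Icc, hu0, mul_zero]⟩

theorem eq_zero_of_wd_eq_zero {u : L2I p.L} (hu : u ∈ p.H1star) (h : wd u = 0) : u = 0 := by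
  have h1 := hasWeakDeriv_wd hu.1
  rw [h] at h1
  obtain ⟨c, hc⟩ := h1.ae_eq_prim p.hL
  have hp : ∀ x, prim (0 : L2I p.L) x = 0 := fun x => by
    refine integral_eq_zero_of_ae ?_
    exact ae_mono (Measure.restrict_mono inter_subset_left le_rfl)
      (Lp.coeFn_zero ℂ 2 (volume.restrict (Ioo 0 p.L)))
  simp only [hp, add_zero] at hc
  have h0 : val u 0 = c := val_eq p.hL (w := fun _ => c) ⟨continuousOn_const, hc⟩ p.zero_mem_Icc
  refine Lp.ext ?_
  filter_upwards [hc, Lp.coeFn_zero ℂ 2 (volume.restrict (Ioo 0 p.L))] with x h2 h3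
  rw [h2, h3, ← h0, hu.2]; rfl

/-- The state space `H¹_*(0,L) × L²(0,L) × L²(ℝ) × H¹_*(0,L) × L²(0,L) × L²(ℝ)` of the tuples
`(V, f, φ₁, P, g, φ₂)`; it carries the energy inner product, not a product norm. -/
def State : Type := p.H1star × L2I p.L × L2R × p.H1star × L2I p.L × L2R

instance : AddCommGroup p.State :=
  inferInstanceAs (AddCommGroup (p.H1star × L2I p.L × L2R × p.H1star × L2I p.L × L2R))

instance : Module ℂ p.State :=
  inferInstanceAs (Module ℂ (p.H1star × L2I p.L × L2R × p.H1star × L2I p.L × L2R))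

end Params

namespace Params.State

variable {p : Params}

/-- Displacement. -/
def V (U : p.State) : L2I p.L := U.1.1
/-- Velocity of the displacement. -/
def f (U : p.State) : L2I p.L := U.2.1
/-- First diffusive variable. -/
def φ₁ (U : p.State) : L2R := U.2.2.1
/-- Electric charge. -/
def P (U : p.State) : L2I p.L := U.2.2.2.1.1
/-- Current. -/
def g (U : p.State) : L2I p.L := U.2.2.2.2.1
/-- Second diffusive variable. -/
def φ₂ (U : p.State) : L2R := U.2.2.2.2.2

/-- The state with the given components. -/
def mk (V : L2I p.L) (hV : V ∈ p.H1star) (f : L2I p.L) (φ₁ : L2R) (P : L2I p.L)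
    (hP : P ∈ p.H1star) (g : L2I p.L) (φ₂ : L2R) : p.State := (⟨V, hV⟩, f, φ₁, ⟨P, hP⟩, g, φ₂)

section

variable (V₀ : L2I p.L) (hV₀ : V₀ ∈ p.H1star) (f₀ : L2I p.L) (φ₀ : L2R) (P₀ : L2I p.L)
  (hP₀ : P₀ ∈ p.H1star) (g₀ : L2I p.L) (ψ₀ : L2R)

@[simp] theorem V_mk : V (mk V₀ hV₀ f₀ φ₀ P₀ hP₀ g₀ ψ₀) = V₀ := rfl
@[simp] theorem f_mk : f (mk V₀ hV₀ f₀ φ₀ P₀ hP₀ g₀ ψ₀) = f₀ := rfl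
@[simp] theorem φ₁_mk : φ₁ (mk V₀ hV₀ f₀ φ₀ P₀ hP₀ g₀ ψ₀) = φ₀ := rfl
@[simp] theorem P_mk : P (mk V₀ hV₀ f₀ φ₀ P₀ hP₀ g₀ ψ₀) = P₀ := rfl
@[simp] theorem g_mk : g (mk V₀ hV₀ f₀ φ₀ P₀ hP₀ g₀ ψ₀) = g₀ := rfl
@[simp] theorem φ₂_mk : φ₂ (mk V₀ hV₀ f₀ φ₀ P₀ hP₀ g₀ ψ₀) = ψ₀ := rfl

end

variable (U W : p.State) (z : ℂ)

theorem hV : V U ∈ p.H1star := U.1.2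
theorem hP : P U ∈ p.H1star := U.2.2.2.1.2

@[simp] theorem V_add : V (U + W) = V U + V W := rfl
@[simp] theorem f_add : f (U + W) = f U + f W := rfl
@[simp] theorem φ₁_add : φ₁ (U + W) = φ₁ U + φ₁ W := rfl
@[simp] theorem P_add : P (U + W) = P U + P W := rfl
@[simp] theorem g_add : g (U + W) = g U + g W := rfl
@[simp] theorem φ₂_add : φ₂ (U + W) = φ₂ U + φ₂ W := rfl
@[simp] theorem V_smul : V (z • U) = z • V U := rfl
@[simp] theorem f_smul : f (z • U) = z • f U := rfl
@[simp] theorem φ₁_smul : φ₁ (z • U) = z • φ₁ U := rfl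
@[simp] theorem P_smul : P (z • U) = z • P U := rfl
@[simp] theorem g_smul : g (z • U) = z • g U := rfl
@[simp] theorem φ₂_smul : φ₂ (z • U) = z • φ₂ U := rfl
@[simp] theorem V_zero : V (0 : p.State) = 0 := rfl
@[simp] theorem f_zero : f (0 : p.State) = 0 := rfl
@[simp] theorem φ₁_zero : φ₁ (0 : p.State) = 0 := rfl
@[simp] theorem P_zero : P (0 : p.State) = 0 := rfl
@[simp] theorem g_zero : g (0 : p.State) = 0 := rfl
@[simp] theorem φ₂_zero : φ₂ (0 : p.State) = 0 := rfl

variable {U W} in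
theorem ext (h1 : V U = V W) (h2 : f U = f W) (h3 : φ₁ U = φ₁ W) (h4 : P U = P W)
    (h5 : g U = g W) (h6 : φ₂ U = φ₂ W) : U = W :=
  Prod.ext (Subtype.ext h1) (Prod.ext h2 (Prod.ext h3 (Prod.ext (Subtype.ext h4)
    (Prod.ext h5 h6))))

/-- `V_x`. -/
def Vx : L2I p.L := wd (V U)
/-- `P_x`. -/
def Px : L2I p.L := wd (P U)

@[simp] theorem Vx_add : Vx (U + W) = Vx U + Vx W := wd_add U.hV.1 W.hV.1
@[simp] theorem Px_add : Px (U + W) = Px U + Px W := wd_add U.hP.1 W.hP.1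
@[simp] theorem Vx_smul : Vx (z • U) = z • Vx U := wd_smul z U.hV.1
@[simp] theorem Px_smul : Px (z • U) = z • Px U := wd_smul z U.hP.1
@[simp] theorem Vx_zero : Vx (0 : p.State) = 0 := wd_zero
@[simp] theorem Px_zero : Px (0 : p.State) = 0 := wd_zero

/-- The energy inner product
`∫₀ᴸ (ρ f₁ f̄₂ + μ g₁ ḡ₂ + α₁ V₁ₓ V̄₂ₓ + β (γV₁ₓ - P₁ₓ) conj(γV₂ₓ - P₂ₓ)) dx
  + (sin(aπ)/π) ∫ (l₁ φ₁,₁ φ̄₁,₂ + l₂ φ₂,₁ φ̄₂,₂) dξ` of `U₁ = W` with `U₂ = U`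
(by Mathlib's convention it is the first argument that is conjugated). -/
def energyInner (U W : p.State) : ℂ :=
  p.ρ * inner ℂ U.f W.f + p.μ * inner ℂ U.g W.g + p.α₁ * inner ℂ U.Vx W.Vx
    + p.β * inner ℂ ((p.γ : ℂ) • U.Vx - U.Px) ((p.γ : ℂ) • W.Vx - W.Px)
    + p.κ * (p.l₁ * inner ℂ U.φ₁ W.φ₁ + p.l₂ * inner ℂ U.φ₂ W.φ₂)

theorem energyInner_self : energyInner U U =
    ((p.ρ * ‖U.f‖ ^ 2 + p.μ * ‖U.g‖ ^ 2 + p.α₁ * ‖U.Vx‖ ^ 2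
      + p.β * ‖(p.γ : ℂ) • U.Vx - U.Px‖ ^ 2
      + p.κ * (p.l₁ * ‖U.φ₁‖ ^ 2 + p.l₂ * ‖U.φ₂‖ ^ 2) : ℝ) : ℂ) := by
  simp only [energyInner, inner_self_eq_norm_sq_to_K]
  push_cast
  rfl

instance core : InnerProductSpace.Core ℂ p.State where
  inner := energyInner
  conj_inner_symm U W := by
    simp only [energyInner, map_add, map_mul, inner_conj_symm, Complex.conj_ofReal]
  re_inner_nonneg U := by
    rw [energyInner_self]
    have := p.hρ; have := p.hμ; have := p.hα₁; have := p.hβ; have := p.hl₁; have := p.hl₂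
    have := p.κ_pos
    simp only [RCLike.re_to_complex, Complex.ofReal_re]
    positivity
  add_left U W Y := by
    have h : (p.γ : ℂ) • (U + W).Vx - (U + W).Px =
        ((p.γ : ℂ) • U.Vx - U.Px) + ((p.γ : ℂ) • W.Vx - W.Px) := by
      rw [Vx_add, Px_add, smul_add]; abel
    simp only [energyInner, h]
    simp only [f_add, g_add, Vx_add, φ₁_add, φ₂_add, inner_add_left]
    ring
  smul_left U W z := by
    have h : (p.γ : ℂ) • (z • U).Vx - (z • U).Px = z • ((p.γ : ℂ) • U.Vx - U.Px) := by
      rw [Vx_smul, Px_smul, smul_sub, smul_comm]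
    simp only [energyInner, h]
    simp only [f_smul, g_smul, Vx_smul, φ₁_smul, φ₂_smul, inner_smul_left]
    ring
  definite U hU := by
    replace hU : energyInner U U = 0 := hU
    rw [energyInner_self, Complex.ofReal_eq_zero] at hU
    have := p.hρ; have := p.hμ; have := p.hα₁; have := p.hβ; have := p.hl₁; have := p.hl₂
    have := p.κ_pos
    have a1 : 0 ≤ p.ρ * ‖U.f‖ ^ 2 := by positivity
    have a2 : 0 ≤ p.μ * ‖U.g‖ ^ 2 := by positivity
    have a3 : 0 ≤ p.α₁ * ‖U.Vx‖ ^ 2 := by positivity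
    have a4 : 0 ≤ p.β * ‖(p.γ : ℂ) • U.Vx - U.Px‖ ^ 2 := by positivity
    have a5 : 0 ≤ p.κ * (p.l₁ * ‖U.φ₁‖ ^ 2) := by positivity
    have a6 : 0 ≤ p.κ * (p.l₂ * ‖U.φ₂‖ ^ 2) := by positivity
    rw [mul_add] at hU
    have e1 : p.ρ * ‖U.f‖ ^ 2 = 0 := by linarith
    have e2 : p.μ * ‖U.g‖ ^ 2 = 0 := by linarith
    have e3 : p.α₁ * ‖U.Vx‖ ^ 2 = 0 := by linarith
    have e4 : p.β * ‖(p.γ : ℂ) • U.Vx - U.Px‖ ^ 2 = 0 := by linarith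
    have e5 : p.κ * (p.l₁ * ‖U.φ₁‖ ^ 2) = 0 := by linarith
    have e6 : p.κ * (p.l₂ * ‖U.φ₂‖ ^ 2) = 0 := by linarith
    have hVx : U.Vx = 0 := by simpa [p.hα₁.ne'] using e3
    have hPx : U.Px = 0 := by simpa [p.hβ.ne', hVx] using e4
    exact State.ext (p.eq_zero_of_wd_eq_zero U.hV hVx) (by simpa [p.hρ.ne'] using e1)
      (by simpa [p.κ_pos.ne', p.hl₁.ne'] using e5) (p.eq_zero_of_wd_eq_zero U.hP hPx)
      (by simpa [p.hμ.ne'] using e2) (by simpa [p.κ_pos.ne', p.hl₂.ne'] using e6)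

end Params.State

namespace Params

variable (p : Params)

instance : NormedAddCommGroup p.State :=
  InnerProductSpace.Core.toNormedAddCommGroup (𝕜 := ℂ) (cd := State.core)

instance : InnerProductSpace ℂ p.State := InnerProductSpace.ofCore State.core.toCore

/-- The function `ξ ↦ -(ξ² + η) φ(ξ) + b |ξ|^((2a-1)/2)`, where `b` stands for a boundary value. -/
def diffusive (φ : L2R) (b : ℂ) (ξ : ℝ) : ℂ :=
  -((ξ ^ 2 + p.η : ℝ) : ℂ) * φ ξ + b * (p.wt ξ : ℂ)

/-- The function `ξ ↦ |ξ| φ(ξ)`. -/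
def absMul (φ : L2R) (ξ : ℝ) : ℂ := ((|ξ| : ℝ) : ℂ) * φ ξ

/-- `(sin(aπ)/π) ∫ |ξ|^((2a-1)/2) φ(ξ) dξ`. -/
def output (φ : L2R) : ℂ := p.κ * ∫ ξ, (p.wt ξ : ℂ) * φ ξ

theorem memLp_wt_div : MemLp (fun ξ => p.wt ξ / (1 + |ξ|)) 2 volume := by
  have ha₀ := p.ha₀
  have ha₁ := p.ha₁
  have hm : AEStronglyMeasurable (fun ξ => p.wt ξ / (1 + |ξ|)) volume := by
    refine Measurable.aestronglyMeasurable ?_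
    unfold wt
    fun_prop
  rw [memLp_two_iff_integrable_sq hm]
  have hm2 : AEStronglyMeasurable (fun ξ => (p.wt ξ / (1 + |ξ|)) ^ 2) volume := hm.pow 2
  have hsq : ∀ ξ : ℝ, 0 < ξ → ‖(p.wt ξ / (1 + |ξ|)) ^ 2‖ = ξ ^ (2 * p.a - 1) / (1 + ξ) ^ 2 := by
    intro ξ hξ
    rw [Real.norm_of_nonneg (sq_nonneg _), div_pow, wt, abs_of_pos hξ, ← Real.rpow_natCast,
      ← Real.rpow_mul hξ.le]
    congr 2; push_cast; ring
  have h1 : IntegrableOn (fun ξ => (p.wt ξ / (1 + |ξ|)) ^ 2) (Ioc 0 1) := by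
    have h := (intervalIntegral.intervalIntegrable_rpow' (a := 0) (b := 1)
      (r := 2 * p.a - 1) (by linarith)).1
    refine h.mono' hm2.restrict ?_
    filter_upwards [ae_restrict_mem measurableSet_Ioc] with ξ hξ
    rw [hsq ξ hξ.1]
    exact div_le_self (Real.rpow_nonneg hξ.1.le _) (by nlinarith [hξ.1])
  have h2 : IntegrableOn (fun ξ => (p.wt ξ / (1 + |ξ|)) ^ 2) (Ioi 1) := by
    have h := integrableOn_Ioi_rpow_of_lt (a := 2 * p.a - 3) (by linarith) zero_lt_one
    refine h.mono' hm2.restrict ?_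
    filter_upwards [ae_restrict_mem measurableSet_Ioi] with ξ hξ
    have hξ0 : 0 < ξ := zero_lt_one.trans hξ
    have e : ξ ^ (2 * p.a - 3) = ξ ^ (2 * p.a - 1) / ξ ^ 2 := by
      rw [← Real.rpow_natCast, ← Real.rpow_sub hξ0]; congr 1; push_cast; ring
    rw [hsq ξ hξ0, e]
    have := Real.rpow_nonneg hξ0.le (2 * p.a - 1)
    gcongr
    linarith
  have h3 : IntegrableOn (fun ξ => (p.wt ξ / (1 + |ξ|)) ^ 2) (Ioi 0) := by
    rw [← Ioc_union_Ioi_eq_Ioi zero_le_one]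
    exact h1.union h2
  have h4 : IntegrableOn (fun ξ => (p.wt ξ / (1 + |ξ|)) ^ 2) (Iio 0) := by
    have h5 := h3
    rw [← neg_zero] at h5
    have h6 := h5.comp_neg_Iio
    simpa only [wt, abs_neg] using h6
  rw [← integrableOn_univ, ← Iio_union_Ici (a := (0 : ℝ))]
  exact h4.union ((integrableOn_Ici_iff_integrableOn_Ioi).2 h3)

theorem integrable_wt_mul {φ : L2R} (hφ : MemLp (absMul φ) 2 volume) :
    Integrable (fun ξ => (p.wt ξ : ℂ) * φ ξ) volume := by
  have h1 : MemLp (fun ξ => φ ξ + absMul φ ξ) 2 volume := (Lp.memLp φ).add hφ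
  have h0 : MemLp (fun ξ => ((p.wt ξ / (1 + |ξ|) : ℝ) : ℂ)) 2 volume := p.memLp_wt_div.ofReal
  have h2 := h0.integrable_mul h1
  refine h2.congr (Filter.Eventually.of_forall fun ξ => ?_)
  have : (1 + ((|ξ| : ℝ) : ℂ)) ≠ 0 := by
    have h : (0 : ℝ) < 1 + |ξ| := by positivity
    exact_mod_cast h.ne'
  have e : φ ξ + ((|ξ| : ℝ) : ℂ) * φ ξ = (1 + ((|ξ| : ℝ) : ℂ)) * φ ξ := by ring
  simp only [Pi.mul_apply, absMul, e]
  push_cast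
  rw [← mul_assoc, div_mul_cancel₀ _ this]

/-- Membership in the domain of the generator: `V, P ∈ H² ∩ H¹_*`, `f, g ∈ H¹_*`,
`|ξ|φᵢ ∈ L²(ℝ)`, the third and sixth component of `A U` are in `L²(ℝ)`, and the boundary conditions
at `x = L` hold. (`V, P ∈ H¹_*` is part of being a state.) -/
structure InDomain (U : p.State) : Prop where
  V_mem : U.V ∈ H2 p.L
  P_mem : U.P ∈ H2 p.L
  f_mem : U.f ∈ p.H1star
  g_mem : U.g ∈ p.H1star
  abs_φ₁ : MemLp (absMul U.φ₁) 2 volume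
  abs_φ₂ : MemLp (absMul U.φ₂) 2 volume
  diff_φ₁ : MemLp (p.diffusive U.φ₁ (val U.f p.L)) 2 volume
  diff_φ₂ : MemLp (p.diffusive U.φ₂ (val U.g p.L)) 2 volume
  bdry_V : p.α * val U.Vx p.L - p.γ * p.β * val U.Px p.L = -p.l₁ * p.output U.φ₁
  bdry_P : p.β * val U.Px p.L - p.γ * p.β * val U.Vx p.L = -p.l₂ * p.output U.φ₂

variable {p} in
theorem InDomain.Vx_mem {U : p.State} (hU : p.InDomain U) : U.Vx ∈ H1 p.L := hU.V_mem.2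

variable {p} in
theorem InDomain.Px_mem {U : p.State} (hU : p.InDomain U) : U.Px ∈ H1 p.L := hU.P_mem.2

theorem absMul_add (φ ψ : L2R) : absMul (φ + ψ) =ᵐ[volume] absMul φ + absMul ψ := by
  filter_upwards [Lp.coeFn_add φ ψ] with ξ h
  simp only [absMul, h, Pi.add_apply, mul_add]

theorem absMul_smul (z : ℂ) (φ : L2R) : absMul (z • φ) =ᵐ[volume] z • absMul φ := by
  filter_upwards [Lp.coeFn_smul z φ] with ξ h
  simp only [absMul, h, Pi.smul_apply, smul_eq_mul]; ring

theorem diffusive_add (φ ψ : L2R) (b c : ℂ) :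
    p.diffusive (φ + ψ) (b + c) =ᵐ[volume] p.diffusive φ b + p.diffusive ψ c := by
  filter_upwards [Lp.coeFn_add φ ψ] with ξ h
  simp only [diffusive, h, Pi.add_apply]; ring

theorem diffusive_smul (z : ℂ) (φ : L2R) (b : ℂ) :
    p.diffusive (z • φ) (z * b) =ᵐ[volume] z • p.diffusive φ b := by
  filter_upwards [Lp.coeFn_smul z φ] with ξ h
  simp only [diffusive, h, Pi.smul_apply, smul_eq_mul]; ring

theorem output_add {φ ψ : L2R} (hφ : MemLp (absMul φ) 2 volume)
    (hψ : MemLp (absMul ψ) 2 volume) : p.output (φ + ψ) = p.output φ + p.output ψ := by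
  rw [output, output, output, ← mul_add,
    ← integral_add (p.integrable_wt_mul hφ) (p.integrable_wt_mul hψ)]
  congr 1
  refine integral_congr_ae ?_
  filter_upwards [Lp.coeFn_add φ ψ] with ξ h
  simp only [h, Pi.add_apply, mul_add]

theorem output_smul (z : ℂ) (φ : L2R) : p.output (z • φ) = z * p.output φ := by
  have : ∫ ξ, (p.wt ξ : ℂ) * (z • φ : L2R) ξ = z * ∫ ξ, (p.wt ξ : ℂ) * φ ξ := by
    rw [← integral_const_mul]
    refine integral_congr_ae ?_
    filter_upwards [Lp.coeFn_smul z φ] with ξ h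
    simp only [h, Pi.smul_apply, smul_eq_mul]; ring
  rw [output, output, this]; ring

variable {p} in
theorem InDomain.add {U W : p.State} (hU : p.InDomain U) (hW : p.InDomain W) :
    p.InDomain (U + W) where
  V_mem := add_mem hU.V_mem hW.V_mem
  P_mem := add_mem hU.P_mem hW.P_mem
  f_mem := add_mem hU.f_mem hW.f_mem
  g_mem := add_mem hU.g_mem hW.g_mem
  abs_φ₁ := (memLp_congr_ae (absMul_add _ _)).2 (hU.abs_φ₁.add hW.abs_φ₁)
  abs_φ₂ := (memLp_congr_ae (absMul_add _ _)).2 (hU.abs_φ₂.add hW.abs_φ₂)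
  diff_φ₁ := by
    rw [State.f_add, val_add p.hL hU.f_mem.1 hW.f_mem.1 p.L_mem_Icc]
    exact (memLp_congr_ae (p.diffusive_add _ _ _ _)).2 (hU.diff_φ₁.add hW.diff_φ₁)
  diff_φ₂ := by
    rw [State.g_add, val_add p.hL hU.g_mem.1 hW.g_mem.1 p.L_mem_Icc]
    exact (memLp_congr_ae (p.diffusive_add _ _ _ _)).2 (hU.diff_φ₂.add hW.diff_φ₂)
  bdry_V := by
    rw [State.Vx_add, State.Px_add, val_add p.hL hU.Vx_mem hW.Vx_mem p.L_mem_Icc,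
      val_add p.hL hU.Px_mem hW.Px_mem p.L_mem_Icc, State.φ₁_add,
      p.output_add hU.abs_φ₁ hW.abs_φ₁]
    linear_combination hU.bdry_V + hW.bdry_V
  bdry_P := by
    rw [State.Vx_add, State.Px_add, val_add p.hL hU.Vx_mem hW.Vx_mem p.L_mem_Icc,
      val_add p.hL hU.Px_mem hW.Px_mem p.L_mem_Icc, State.φ₂_add,
      p.output_add hU.abs_φ₂ hW.abs_φ₂]
    linear_combination hU.bdry_P + hW.bdry_P

variable {p} in
theorem InDomain.smul {U : p.State} (z : ℂ) (hU : p.InDomain U) : p.InDomain (z • U) where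
  V_mem := Submodule.smul_mem _ z hU.V_mem
  P_mem := Submodule.smul_mem _ z hU.P_mem
  f_mem := Submodule.smul_mem _ z hU.f_mem
  g_mem := Submodule.smul_mem _ z hU.g_mem
  abs_φ₁ := (memLp_congr_ae (absMul_smul _ _)).2 (hU.abs_φ₁.const_smul z)
  abs_φ₂ := (memLp_congr_ae (absMul_smul _ _)).2 (hU.abs_φ₂.const_smul z)
  diff_φ₁ := by
    rw [State.f_smul, val_smul p.hL z hU.f_mem.1 p.L_mem_Icc]
    exact (memLp_congr_ae (p.diffusive_smul _ _ _)).2 (hU.diff_φ₁.const_smul z)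
  diff_φ₂ := by
    rw [State.g_smul, val_smul p.hL z hU.g_mem.1 p.L_mem_Icc]
    exact (memLp_congr_ae (p.diffusive_smul _ _ _)).2 (hU.diff_φ₂.const_smul z)
  bdry_V := by
    rw [State.Vx_smul, State.Px_smul, val_smul p.hL z hU.Vx_mem p.L_mem_Icc,
      val_smul p.hL z hU.Px_mem p.L_mem_Icc, State.φ₁_smul, p.output_smul]
    linear_combination z * hU.bdry_V
  bdry_P := by
    rw [State.Vx_smul, State.Px_smul, val_smul p.hL z hU.Vx_mem p.L_mem_Icc,
      val_smul p.hL z hU.Px_mem p.L_mem_Icc, State.φ₂_smul, p.output_smul]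
    linear_combination z * hU.bdry_P

theorem inDomain_zero : p.InDomain 0 := by
  have h0 : p.output 0 = 0 := by simpa using p.output_smul 0 0
  have h1 : absMul 0 =ᵐ[volume] 0 := by simpa using absMul_smul 0 0
  have h2 : p.diffusive 0 0 =ᵐ[volume] 0 := by simpa using p.diffusive_smul 0 0 0
  have h3 : val (0 : L2I p.L) p.L = 0 := val_zero p.hL p.L_mem_Icc
  refine ⟨zero_mem _, zero_mem _, zero_mem _, zero_mem _, ?_, ?_, ?_, ?_, ?_, ?_⟩
  · exact (memLp_congr_ae h1).2 MemLp.zero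
  · exact (memLp_congr_ae h1).2 MemLp.zero
  · rw [State.f_zero, h3]; exact (memLp_congr_ae h2).2 MemLp.zero
  · rw [State.g_zero, h3]; exact (memLp_congr_ae h2).2 MemLp.zero
  · simp [h0, h3]
  · simp [h0, h3]

/-- The domain `D(A)`. -/
def domain : Submodule ℂ p.State where
  carrier := {U | p.InDomain U}
  add_mem' := InDomain.add
  zero_mem' := p.inDomain_zero
  smul_mem' := fun z _ hU => hU.smul z

/-- The action of the generator on `U ∈ D(A)`. -/
def act (U : p.State) (hU : p.InDomain U) : p.State :=
  State.mk
    U.f hU.f_mem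
    (((p.α / p.ρ : ℝ) : ℂ) • wd U.Vx - ((p.γ * p.β / p.ρ : ℝ) : ℂ) • wd U.Px)
    (hU.diff_φ₁.toLp _)
    U.g hU.g_mem
    (-((p.γ * p.β / p.μ : ℝ) : ℂ) • wd U.Vx + ((p.β / p.μ : ℝ) : ℂ) • wd U.Px)
    (hU.diff_φ₂.toLp _)

theorem toLp_add' {F G H : ℝ → ℂ} (hF : MemLp F 2 volume) (hG : MemLp G 2 volume)
    (hH : MemLp H 2 volume) (h : F =ᵐ[volume] G + H) : hF.toLp F = hG.toLp G + hH.toLp H := by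
  rw [← MemLp.toLp_add]
  exact MemLp.toLp_congr _ _ h

theorem toLp_smul' {F G : ℝ → ℂ} (z : ℂ) (hF : MemLp F 2 volume) (hG : MemLp G 2 volume)
    (h : F =ᵐ[volume] z • G) : hF.toLp F = z • hG.toLp G := by
  rw [← MemLp.toLp_const_smul]
  exact MemLp.toLp_congr _ _ h

theorem act_add {U W : p.State} (hU : p.InDomain U) (hW : p.InDomain W) :
    p.act (U + W) (hU.add hW) = p.act U hU + p.act W hW := by
  refine State.ext ?_ ?_ ?_ ?_ ?_ ?_
  · simp only [act, State.V_mk, State.V_add, State.f_add]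
  · simp only [act, State.f_mk, State.f_add, State.Vx_add, State.Px_add,
      wd_add hU.Vx_mem hW.Vx_mem, wd_add hU.Px_mem hW.Px_mem, smul_add]
    abel
  · simp only [act, State.φ₁_mk, State.φ₁_add]
    refine toLp_add' (hU.add hW).diff_φ₁ hU.diff_φ₁ hW.diff_φ₁ ?_
    rw [State.f_add, val_add p.hL hU.f_mem.1 hW.f_mem.1 p.L_mem_Icc]
    exact p.diffusive_add _ _ _ _
  · simp only [act, State.P_mk, State.P_add, State.g_add]
  · simp only [act, State.g_mk, State.g_add, State.Vx_add, State.Px_add,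
      wd_add hU.Vx_mem hW.Vx_mem, wd_add hU.Px_mem hW.Px_mem, smul_add]
    abel
  · simp only [act, State.φ₂_mk, State.φ₂_add]
    refine toLp_add' (hU.add hW).diff_φ₂ hU.diff_φ₂ hW.diff_φ₂ ?_
    rw [State.g_add, val_add p.hL hU.g_mem.1 hW.g_mem.1 p.L_mem_Icc]
    exact p.diffusive_add _ _ _ _

theorem act_smul {U : p.State} (z : ℂ) (hU : p.InDomain U) :
    p.act (z • U) (hU.smul z) = z • p.act U hU := by
  refine State.ext ?_ ?_ ?_ ?_ ?_ ?_
  · simp only [act, State.V_mk, State.V_smul, State.f_smul]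
  · simp only [act, State.f_mk, State.f_smul, State.Vx_smul, State.Px_smul,
      wd_smul z hU.Vx_mem, wd_smul z hU.Px_mem, smul_sub, smul_comm z]
  · simp only [act, State.φ₁_mk, State.φ₁_smul]
    refine toLp_smul' z (hU.smul z).diff_φ₁ hU.diff_φ₁ ?_
    rw [State.f_smul, val_smul p.hL z hU.f_mem.1 p.L_mem_Icc]
    exact p.diffusive_smul _ _ _
  · simp only [act, State.P_mk, State.P_smul, State.g_smul]
  · simp only [act, State.g_mk, State.g_smul, State.Vx_smul, State.Px_smul,
      wd_smul z hU.Vx_mem, wd_smul z hU.Px_mem, smul_add, smul_comm z]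
  · simp only [act, State.φ₂_mk, State.φ₂_smul]
    refine toLp_smul' z (hU.smul z).diff_φ₂ hU.diff_φ₂ ?_
    rw [State.g_smul, val_smul p.hL z hU.g_mem.1 p.L_mem_Icc]
    exact p.diffusive_smul _ _ _

/-- The generator `A : D(A) ⊂ H → H` of the beam without thermal effects. -/
def generator : p.State →ₗ.[ℂ] p.State where
  domain := p.domain
  toFun :=
    { toFun := fun U => p.act U.1 U.2
      map_add' := fun U W => p.act_add U.2 W.2
      map_smul' := fun z U => p.act_smul z U.2 }

end Params

/-- The resolvent set of an unbounded operator `A`: the `z` for which `z - A : D(A) → E` is a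
bijection with a bounded inverse. -/
def resolventSet {E : Type*} [NormedAddCommGroup E] [NormedSpace ℂ E] (A : E →ₗ.[ℂ] E) : Set ℂ :=
  {z | ∃ R : E →L[ℂ] E, (∀ x : A.domain, R (z • (x : E) - A x) = x) ∧
    ∀ y : E, ∃ x : A.domain, (x : E) = R y ∧ z • (x : E) - A x = y}

end
end Piezo

namespace Piezo

section

open MeasureTheory Set

/-! Fix `z` with `Re z = 0`; the resolvent equation is reduced to a two-point boundary value problem
for a linear ODE in `ℂ⁴`. In `zU - AU = F` the velocities are `f = zV - F.V` and `g = zP - F.P`. The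
diffusive equations are solved pointwise: `φ = (F.φ + b m) / (ξ² + η + z)`, where `b` is the value
at `L` of `f` or `g`. Since `η > 0`, the denominator has modulus at least `η` on the whole imaginary
axis, so `z = 0` needs no separate argument here. The output of `φ` is then a bounded functional of
`F.φ` plus `b k`, where `k`, the output of `m / (ξ² + η + z)`, has positive real part
(`output_ker_re_pos`). With the stresses `S₁ = αV_x - γβP_x` and `S₂ = βP_x - γβV_x`, what remains
is a first order system for `(V, P, S₁, S₂)` with `V = P = 0` at `0` and the absorbing conditions
`S₁ + l₁k zV = r₁`, `S₂ + l₂k zP = r₂` at `L`.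

Uniqueness for this problem (`eq_zero_of_homogeneous`) is an energy argument. As `z²` is real, the
imaginary part of `S₁V̄ + S₂P̄` is constant in `x`, and it vanishes at `0`. At `L` the absorbing
conditions turn it into a definite form in `V(L)`, `P(L)` times `z`. For `z ≠ 0` all Cauchy data at
`L` therefore vanish, hence so does the solution; for `z = 0` the system integrates directly.

Existence is Fredholm's alternative in dimension two: the shooting map from `(S₁(0), S₂(0))` to the
boundary expressions at `L` is an injective endomorphism of `ℂ²`, hence invertible (`exists_bvp`).
The forcing is only `L²`, so the inhomogeneous system is kept in integrated form, as a Volterra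
equation with continuous right-hand side (`exists_volterra`), and is read back as weak derivatives
(`exists_weak_bvp`). Each step carries a constant independent of `F`, so the solution is bounded by
`‖F‖`, which with injectivity puts `z` in the resolvent set. -/

/-- A function with vanishing derivative on `[a, b]` is constant there. -/
theorem eq_left_of_hasDerivWithinAt_zero {E : Type*} [NormedAddCommGroup E] [NormedSpace ℝ E]
    {f : ℝ → E} {a b : ℝ} (hab : a < b)
    (h : ∀ x ∈ Icc a b, HasDerivWithinAt f 0 (Icc a b) x) : ∀ x ∈ Icc a b, f x = f a :=
  constant_of_derivWithin_zero (fun x hx => (h x hx).differentiableWithinAt) fun x hx =>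
    (h x (Ico_subset_Icc_self hx)).derivWithin (uniqueDiffOn_Icc hab x (Ico_subset_Icc_self hx))

/-! ### The homogeneous boundary value problem -/

namespace Params

variable (p : Params)

/-- The phase space of `(V, P, αV_x - γβP_x, βP_x - γβV_x)`. -/
abbrev Phase : Type := ℂ × ℂ × ℂ × ℂ

/-- The matrix of the resolvent equation at `z`, written as a first order system. -/
noncomputable def sysMat (z : ℂ) : Phase →L[ℂ] Phase :=
  LinearMap.toContinuousLinearMap
    { toFun := fun y => ((y.2.2.1 + p.γ * y.2.2.2) / p.α₁,
        (p.γ * y.2.2.1 + p.α / p.β * y.2.2.2) / p.α₁,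
        p.ρ * z ^ 2 * y.1, p.μ * z ^ 2 * y.2.1)
      map_add' := fun x y => by
        ext <;> simp <;> ring
      map_smul' := fun c y => by
        ext <;> simp <;> ring }

theorem sysMat_apply (z : ℂ) (y : Phase) : p.sysMat z y =
    ((y.2.2.1 + p.γ * y.2.2.2) / p.α₁, (p.γ * y.2.2.1 + p.α / p.β * y.2.2.2) / p.α₁,
        p.ρ * z ^ 2 * y.1, p.μ * z ^ 2 * y.2.1) := rfl

/-- The homogeneous boundary value problem with absorbing boundary condition at `L` has only the
trivial solution when `z` is purely imaginary. -/
theorem eq_zero_of_homogeneous {z d₁ d₂ : ℂ} (hz : z.re = 0) (hd₁ : 0 < d₁.re) (hd₂ : 0 < d₂.re)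
    {Y : ℝ → Phase} (hY : ∀ x ∈ Icc 0 p.L, HasDerivWithinAt Y (p.sysMat z (Y x)) (Icc 0 p.L) x)
    (h0 : (Y 0).1 = 0) (h0' : (Y 0).2.1 = 0)
    (hL₁ : (Y p.L).2.2.1 + d₁ * (z * (Y p.L).1) = 0)
    (hL₂ : (Y p.L).2.2.2 + d₂ * (z * (Y p.L).2.1) = 0) :
    ∀ x ∈ Icc 0 p.L, Y x = 0 := by
  -- This is where `Re z = 0` enters: it makes `z²` its own conjugate.
  have hz' : (starRingEnd ℂ) z = -z := by
    apply Complex.ext <;> simp [hz]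
  have hV : ∀ x ∈ Icc 0 p.L, HasDerivWithinAt (fun x => (Y x).1)
      (((Y x).2.2.1 + p.γ * (Y x).2.2.2) / p.α₁) (Icc 0 p.L) x := fun x hx => (hY x hx).fst
  have hP : ∀ x ∈ Icc 0 p.L, HasDerivWithinAt (fun x => (Y x).2.1)
      ((p.γ * (Y x).2.2.1 + p.α / p.β * (Y x).2.2.2) / p.α₁) (Icc 0 p.L) x :=
    fun x hx => (hY x hx).snd.fst
  have hs : ∀ x ∈ Icc 0 p.L, HasDerivWithinAt (fun x => (Y x).2.2.1)
      (p.ρ * z ^ 2 * (Y x).1) (Icc 0 p.L) x := fun x hx => (hY x hx).snd.snd.fst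
  have ht : ∀ x ∈ Icc 0 p.L, HasDerivWithinAt (fun x => (Y x).2.2.2)
      (p.μ * z ^ 2 * (Y x).2.1) (Icc 0 p.L) x := fun x hx => (hY x hx).snd.snd.snd
  -- The energy identity used for `z ≠ 0` carries a factor `z` and says nothing at `z = 0`. There
  -- the stresses are constant and vanish at `L`, so `V` and `P` are constant and vanish at `0`.
  by_cases hz0 : z = 0
  · subst hz0
    have es : ∀ x ∈ Icc 0 p.L, (Y x).2.2.1 = 0 := by
      have h := eq_left_of_hasDerivWithinAt_zero p.hL (fun x hx => by simpa using hs x hx)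
      intro x hx
      rw [h x hx, ← h p.L p.L_mem_Icc]
      simpa using hL₁
    have et : ∀ x ∈ Icc 0 p.L, (Y x).2.2.2 = 0 := by
      have h := eq_left_of_hasDerivWithinAt_zero p.hL (fun x hx => by simpa using ht x hx)
      intro x hx
      rw [h x hx, ← h p.L p.L_mem_Icc]
      simpa using hL₂
    have eV := eq_left_of_hasDerivWithinAt_zero p.hL
      (fun x hx => by simpa [es x hx, et x hx] using hV x hx)
    have eP := eq_left_of_hasDerivWithinAt_zero p.hL
      (fun x hx => by simpa [es x hx, et x hx] using hP x hx)
    intro x hx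
    ext1
    · simpa [h0] using eV x hx
    ext1
    · simpa [h0'] using eP x hx
    ext1
    · exact es x hx
    · exact et x hx
  set c := starRingEnd ℂ with hc
  -- Lagrange's identity. The real symmetric matrix expressing `(V_x, P_x)` through the stresses and
  -- the real number `z²` make the derivative of `S₁V̄ + S₂P̄` real, so its difference from its
  -- conjugate is constant.
  have hq : ∀ x ∈ Icc 0 p.L, HasDerivWithinAt
      (fun x => ((Y x).2.2.1 * c (Y x).1 + (Y x).2.2.2 * c (Y x).2.1)
        - (c (Y x).2.2.1 * (Y x).1 + c (Y x).2.2.2 * (Y x).2.1)) 0 (Icc 0 p.L) x := by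
    intro x hx
    have hV := hV x hx
    have hP := hP x hx
    have hs := hs x hx
    have ht := ht x hx
    refine ((((hs.mul hV.star).add (ht.mul hP.star)).sub
      ((hs.star.mul hV).add (ht.star.mul hP))).congr_deriv ?_)
    simp only [← starRingEnd_apply, ← hc, map_div₀, map_mul, map_add, map_pow, hz']
    simp only [hc, Complex.conj_ofReal]
    ring
  have hqL := eq_left_of_hasDerivWithinAt_zero p.hL hq p.L p.L_mem_Icc
  simp only [h0, h0', map_zero, mul_zero, add_zero, sub_zero] at hqL
  have e1 : (Y p.L).2.2.1 = -(d₁ * (z * (Y p.L).1)) := by linear_combination hL₁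
  have e2 : (Y p.L).2.2.2 = -(d₂ * (z * (Y p.L).2.1)) := by linear_combination hL₂
  rw [e1, e2] at hqL
  simp only [map_neg, map_mul, hz'] at hqL
  -- Because `conj z = -z`, the two boundary terms add up to `2 Re d` instead of cancelling.
  have e3 : z * ((d₁ + c d₁) * ((Y p.L).1 * c (Y p.L).1)
      + (d₂ + c d₂) * ((Y p.L).2.1 * c (Y p.L).2.1)) = 0 := by
    linear_combination -hqL
  have e4 := (mul_eq_zero.1 e3).resolve_left hz0
  simp only [hc, Complex.add_conj, Complex.mul_conj] at e4
  have e5 : 2 * d₁.re * Complex.normSq (Y p.L).1 + 2 * d₂.re * Complex.normSq (Y p.L).2.1 = 0 := by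
    exact_mod_cast e4
  have n1 := Complex.normSq_nonneg (Y p.L).1
  have n2 := Complex.normSq_nonneg (Y p.L).2.1
  have m1 := mul_nonneg (mul_nonneg zero_le_two hd₁.le) n1
  have m2 := mul_nonneg (mul_nonneg zero_le_two hd₂.le) n2
  have v1 : (Y p.L).1 = 0 := by
    have : 2 * d₁.re * Complex.normSq (Y p.L).1 = 0 := by linarith
    simpa [hd₁.ne'] using this
  have v2 : (Y p.L).2.1 = 0 := by
    have : 2 * d₂.re * Complex.normSq (Y p.L).2.1 = 0 := by linarith
    simpa [hd₂.ne'] using this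
  have hYL : Y p.L = 0 := by
    ext1
    · exact v1
    ext1
    · exact v2
    ext1
    · simp [e1, v1]
    · simp [e2, v2]
  have hnhds : ∀ t ∈ Ioc 0 p.L, Icc 0 p.L ∈ nhdsWithin t (Iic t) := fun t ht =>
    Filter.mem_of_superset (inter_mem_nhdsWithin _ (Ioi_mem_nhds ht.1))
      fun y hy => ⟨hy.2.le, hy.1.trans ht.2⟩
  -- The vanishing Cauchy data sit at the right endpoint, so uniqueness is run backwards from `L`.
  exact ODE_solution_unique_of_mem_Icc_left (v := fun _ => p.sysMat z) (s := fun _ => univ)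
    (g := fun _ => 0) (fun t _ => (p.sysMat z).lipschitz.lipschitzOnWith)
    (fun x hx => (hY x hx).continuousWithinAt)
    (fun t ht => (hY t (Ioc_subset_Icc_self ht)).mono_of_mem_nhdsWithin (hnhds t ht))
    (fun _ _ => mem_univ _) continuousOn_const
    (fun t _ => by simpa using hasDerivWithinAt_const t (Iic t) (0 : Phase))
    (fun _ _ => mem_univ _) hYL

end Params

/-! ### Linear systems with constant coefficients -/

section LinearODE

variable {E : Type*} [NormedAddCommGroup E] [NormedSpace ℂ E]

theorem exp_ofReal_zero_smul (B : E →L[ℂ] E) : NormedSpace.exp (((0 : ℝ) : ℂ) • B) = 1 := by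
  simp

/-- The operators are complex linear but the variable is real, so the product rule is applied after
restricting scalars to `ℝ`. -/
theorem hasDerivAt_clm_apply_real {A : ℝ → E →L[ℂ] E} {A' : E →L[ℂ] E} {u : ℝ → E} {u' : E} {x : ℝ}
    (hA : HasDerivAt A A' x) (hu : HasDerivAt u u' x) :
    HasDerivAt (fun y => A y (u y)) (A' (u x) + A x u') x := by
  have h1 := ((ContinuousLinearMap.restrictScalarsL ℂ E E ℝ ℝ).hasFDerivAt).comp_hasDerivAt x hA
  exact h1.clm_apply hu

variable [CompleteSpace E]

theorem hasDerivAt_exp_ofReal_smul (B : E →L[ℂ] E) (x : ℝ) :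
    HasDerivAt (fun x : ℝ => NormedSpace.exp ((x : ℂ) • B))
      (B * NormedSpace.exp ((x : ℂ) • B)) x := by
  have h := (hasDerivAt_exp_smul_const' B (x : ℂ)).scomp x Complex.ofRealCLM.hasDerivAt
  rw [Complex.ofRealCLM_apply, Complex.ofReal_one, one_smul] at h
  exact h

theorem continuous_exp_ofReal_smul (B : E →L[ℂ] E) :
    Continuous (fun x : ℝ => NormedSpace.exp ((x : ℂ) • B)) :=
  continuous_iff_continuousAt.2 fun x => (hasDerivAt_exp_ofReal_smul B x).continuousAt

theorem exp_mul_exp_neg (B : E →L[ℂ] E) (x : ℝ) :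
    NormedSpace.exp ((x : ℂ) • B) * NormedSpace.exp (((-x : ℝ) : ℂ) • B) = 1 := by
  let _ : NormedAlgebra ℚ (E →L[ℂ] E) := NormedAlgebra.restrictScalars ℚ ℂ _
  rw [← NormedSpace.exp_add_of_commute]
  · simp
  · exact ((Commute.refl B).smul_left _).smul_right _

theorem hasDerivAt_exp_apply (B : E →L[ℂ] E) (c : E) (x : ℝ) :
    HasDerivAt (fun x : ℝ => NormedSpace.exp ((x : ℂ) • B) c)
      (B (NormedSpace.exp ((x : ℂ) • B) c)) x := by
  have h := hasDerivAt_clm_apply_real (hasDerivAt_exp_ofReal_smul B x) (hasDerivAt_const x c)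
  simpa using h

/-- The Volterra equation `Y = g + ∫₀ˣ B Y` is solvable for continuous `g`, with a bound. -/
theorem exists_volterra (B : E →L[ℂ] E) {L : ℝ} (hL : 0 < L) : ∃ C, 0 ≤ C ∧ ∀ g : ℝ → E,
    Continuous g → ∃ Y : ℝ → E, Continuous Y ∧ (∀ x, Y x = g x + ∫ t in (0 : ℝ)..x, B (Y t)) ∧
      ∀ M, (∀ x ∈ Icc 0 L, ‖g x‖ ≤ M) → ∀ x ∈ Icc 0 L, ‖Y x‖ ≤ C * M := by
  have hce := continuous_exp_ofReal_smul B
  -- The symmetric interval bounds both `exp(xB)` and the inverse propagator `exp(-tB)`.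
  obtain ⟨K, hK⟩ := (isCompact_Icc (a := -L) (b := L)).exists_bound_of_continuousOn hce.continuousOn
  have hK0 : 0 ≤ K := (norm_nonneg _).trans (hK 0 ⟨by linarith, hL.le⟩)
  refine ⟨1 + K * (K * ‖B‖ * L), by positivity, fun g hg => ?_⟩
  -- Variation of constants for `Z = Y - g`, which solves `Z' = B(Z + g)`, `Z(0) = 0`. Working with
  -- `Z` avoids differentiating `g`.
  set k : ℝ → E := fun t => NormedSpace.exp (((-t : ℝ) : ℂ) • B) (B (g t)) with hk
  have hkc : Continuous k := (hce.comp continuous_neg).clm_apply (B.continuous.comp hg)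
  set Z : ℝ → E := fun x => NormedSpace.exp ((x : ℂ) • B) (∫ t in (0 : ℝ)..x, k t) with hZ
  have hZd : ∀ x, HasDerivAt Z (B (Z x + g x)) x := by
    intro x
    have h1 : HasDerivAt (fun x => ∫ t in (0 : ℝ)..x, k t) (k x) x :=
      intervalIntegral.integral_hasDerivAt_right (hkc.intervalIntegrable _ _)
        (hkc.stronglyMeasurableAtFilter _ _) hkc.continuousAt
    refine (hasDerivAt_clm_apply_real (hasDerivAt_exp_ofReal_smul B x) h1).congr_deriv ?_
    have h2 : NormedSpace.exp ((x : ℂ) • B) (k x) = B (g x) := by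
      have h3 := congrArg (fun T : E →L[ℂ] E => T (B (g x))) (exp_mul_exp_neg B x)
      exact h3
    rw [h2, map_add]; rfl
  have hZc : Continuous Z := continuous_iff_continuousAt.2 fun x => (hZd x).continuousAt
  refine ⟨fun x => Z x + g x, hZc.add hg, fun x => ?_, fun M hM x hx => ?_⟩
  · rw [intervalIntegral.integral_eq_sub_of_hasDerivAt (fun x _ => hZd x)
      ((B.continuous.comp (hZc.add hg)).intervalIntegrable _ _)]
    simp [hZ, add_comm]
  · have h1 : ‖∫ t in (0 : ℝ)..x, k t‖ ≤ K * ‖B‖ * M * |x - 0| := by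
      refine intervalIntegral.norm_integral_le_of_norm_le_const fun t ht => ?_
      rw [uIoc_of_le hx.1] at ht
      have ht' : t ∈ Icc 0 L := ⟨ht.1.le, ht.2.trans hx.2⟩
      calc ‖k t‖ ≤ ‖NormedSpace.exp (((-t : ℝ) : ℂ) • B)‖ * (‖B‖ * ‖g t‖) :=
            (ContinuousLinearMap.le_opNorm _ _).trans (by gcongr; exact B.le_opNorm _)
        _ ≤ K * (‖B‖ * M) := by
            gcongr
            · exact hK _ ⟨by linarith [ht'.2], by linarith [ht'.1]⟩
            · exact hM t ht'
        _ = K * ‖B‖ * M := by ring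
    have hM0 : 0 ≤ M := (norm_nonneg _).trans (hM x hx)
    rw [sub_zero, abs_of_nonneg hx.1] at h1
    have h2 : ‖Z x‖ ≤ K * (K * ‖B‖ * M * L) :=
      (ContinuousLinearMap.le_opNorm _ _).trans (mul_le_mul (hK x ⟨by linarith [hx.1], hx.2⟩)
        (h1.trans (by gcongr; exact hx.2)) (norm_nonneg _) hK0)
    calc ‖Z x + g x‖ ≤ ‖Z x‖ + ‖g x‖ := norm_add_le _ _
      _ ≤ K * (K * ‖B‖ * M * L) + M := add_le_add h2 (hM x hx)
      _ = (1 + K * (K * ‖B‖ * L)) * M := by ring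

end LinearODE

/-! ### Shooting for the inhomogeneous problem -/

namespace Params

variable (p : Params)

/-- Solvability, with a bound, of the boundary value problem with absorbing boundary condition. -/
theorem exists_bvp {z d₁ d₂ : ℂ} (hz : z.re = 0) (hd₁ : 0 < d₁.re) (hd₂ : 0 < d₂.re) :
    ∃ C, 0 ≤ C ∧ ∀ (g : ℝ → Phase) (r : ℂ × ℂ) (M : ℝ), Continuous g → g 0 = 0 →
      (∀ x ∈ Icc 0 p.L, ‖g x‖ ≤ M) → ‖r‖ ≤ M → ∃ Y : ℝ → Phase, Continuous Y ∧
        (Y 0).1 = 0 ∧ (Y 0).2.1 = 0 ∧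
        (∀ x, Y x = Y 0 + g x + ∫ t in (0 : ℝ)..x, p.sysMat z (Y t)) ∧
        (Y p.L).2.2.1 + d₁ * (z * (Y p.L).1) = r.1 ∧
        (Y p.L).2.2.2 + d₂ * (z * (Y p.L).2.1) = r.2 ∧
        ∀ x ∈ Icc 0 p.L, ‖Y x‖ ≤ C * M := by
  obtain ⟨C₁, hC₁, hvol⟩ := exists_volterra (p.sysMat z) p.hL
  -- the boundary functional and the shooting map
  let bd : Phase →ₗ[ℂ] ℂ × ℂ :=
    { toFun := fun y => (y.2.2.1 + d₁ * (z * y.1), y.2.2.2 + d₂ * (z * y.2.1))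
      map_add' := fun x y => by ext <;> simp <;> ring
      map_smul' := fun c y => by ext <;> simp <;> ring }
  let ι : ℂ × ℂ →ₗ[ℂ] Phase := LinearMap.inr ℂ ℂ (ℂ × ℂ × ℂ) ∘ₗ LinearMap.inr ℂ ℂ (ℂ × ℂ)
  let Φ : ℝ → Phase →L[ℂ] Phase := fun x => NormedSpace.exp ((x : ℂ) • p.sysMat z)
  let N : ℂ × ℂ →ₗ[ℂ] ℂ × ℂ := bd ∘ₗ (Φ p.L).toLinearMap ∘ₗ ι
  have hΦ0 : ∀ c, Φ 0 c = c := fun c => by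
    change NormedSpace.exp (((0 : ℝ) : ℂ) • p.sysMat z) c = c
    rw [exp_ofReal_zero_smul, one_apply_eq_self]
  have hΦ : ∀ c x, HasDerivAt (fun x => Φ x c) (p.sysMat z (Φ x c)) x := fun c x =>
    hasDerivAt_exp_apply _ c x
  have hΦc : ∀ c, Continuous fun x => Φ x c := fun c =>
    continuous_iff_continuousAt.2 fun x => (hΦ c x).continuousAt
  -- A kernel element is an initial stress whose solution satisfies every homogeneous boundary
  -- condition. Injectivity suffices for invertibility because `N` is an endomorphism of `ℂ²`.
  have hN : Function.Injective N := by
    refine (injective_iff_map_eq_zero N).2 fun s hs => ?_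
    have h1 := congrArg Prod.fst hs
    have h2 := congrArg Prod.snd hs
    have h := p.eq_zero_of_homogeneous hz hd₁ hd₂ (Y := fun x => Φ x (ι s))
      (fun x _ => (hΦ _ x).hasDerivWithinAt) (by simp [hΦ0, ι]) (by simp [hΦ0, ι])
      h1 h2 0 p.zero_mem_Icc
    simp only [hΦ0] at h
    have h3 := congrArg (fun y : Phase => y.2.2) h
    simpa [ι] using h3
  let e : (ℂ × ℂ) ≃L[ℂ] (ℂ × ℂ) :=
    (LinearEquiv.ofBijective N ⟨hN, LinearMap.injective_iff_surjective.1 hN⟩).toContinuousLinearEquiv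
  have he : ∀ s, e s = N s := fun _ => rfl
  let bdC := LinearMap.toContinuousLinearMap bd
  let ιC := LinearMap.toContinuousLinearMap ι
  let S := (e.symm : ℂ × ℂ →L[ℂ] ℂ × ℂ)
  obtain ⟨K, hK⟩ := (isCompact_Icc (a := 0) (b := p.L)).exists_bound_of_continuousOn
    (continuous_exp_ofReal_smul (p.sysMat z)).continuousOn
  have hK0 : 0 ≤ K := (norm_nonneg _).trans (hK 0 p.zero_mem_Icc)
  refine ⟨C₁ + K * (‖ιC‖ * (‖S‖ * (1 + ‖bdC‖ * C₁))), by positivity,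
    fun g r M hg hg0 hgM hr => ?_⟩
  obtain ⟨Y₀, hY₀c, hY₀, hY₀M⟩ := hvol g hg
  replace hY₀M := hY₀M M hgM
  have hY00 : Y₀ 0 = 0 := by rw [hY₀ 0, hg0]; simp
  -- The initial stress whose free solution cancels the boundary defect left at `L` by the Volterra
  -- solution `Y₀`.
  set s : ℂ × ℂ := S (r - bdC (Y₀ p.L)) with hs
  have hNs : N s = r - bd (Y₀ p.L) := by rw [← he]; exact e.apply_symm_apply _
  have hbd : bd (Y₀ p.L + Φ p.L (ι s)) = r := by
    rw [map_add, show bd (Φ p.L (ι s)) = N s from rfl, hNs]; abel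
  have hsn : ‖ι s‖ ≤ ‖ιC‖ * (‖S‖ * (1 + ‖bdC‖ * C₁)) * M := by
    have h1 : ‖bdC (Y₀ p.L)‖ ≤ ‖bdC‖ * (C₁ * M) :=
      (bdC.le_opNorm _).trans (by gcongr; exact hY₀M _ p.L_mem_Icc)
    have h2 : ‖s‖ ≤ ‖S‖ * (M + ‖bdC‖ * (C₁ * M)) :=
      (S.le_opNorm _).trans (by gcongr; exact (norm_sub_le _ _).trans (add_le_add hr h1))
    calc ‖ι s‖ ≤ ‖ιC‖ * ‖s‖ := ιC.le_opNorm _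
      _ ≤ ‖ιC‖ * (‖S‖ * (M + ‖bdC‖ * (C₁ * M))) := by gcongr
      _ = _ := by ring
  have hYzero : Y₀ 0 + Φ 0 (ι s) = ι s := by rw [hY00, hΦ0, zero_add]
  refine ⟨fun x => Y₀ x + Φ x (ι s), hY₀c.add (hΦc _), ?_, ?_, fun x => ?_,
    congrArg Prod.fst hbd, congrArg Prod.snd hbd, fun x hx => ?_⟩
  · simp only [hYzero]; simp [ι]
  · simp only [hYzero]; simp [ι]
  · simp only [hYzero, map_add]
    have hadd := intervalIntegral.integral_add (μ := volume)
      (((p.sysMat z).continuous.comp hY₀c).intervalIntegrable 0 x)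
      (((p.sysMat z).continuous.comp (hΦc (ι s))).intervalIntegrable 0 x)
    simp only [Function.comp_apply] at hadd
    rw [hadd, intervalIntegral.integral_eq_sub_of_hasDerivAt (fun x _ => hΦ (ι s) x)
      (((p.sysMat z).continuous.comp (hΦc _)).intervalIntegrable _ _), hΦ0]
    conv_lhs => rw [hY₀ x]
    abel
  · have h1 : ‖Φ x (ι s)‖ ≤ K * (‖ιC‖ * (‖S‖ * (1 + ‖bdC‖ * C₁)) * M) :=
      ((Φ x).le_opNorm _).trans (mul_le_mul (hK x hx) hsn (norm_nonneg _) hK0)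
    calc _ ≤ ‖Y₀ x‖ + ‖Φ x (ι s)‖ := norm_add_le _ _
      _ ≤ C₁ * M + K * (‖ιC‖ * (‖S‖ * (1 + ‖bdC‖ * C₁)) * M) := add_le_add (hY₀M x hx) h1
      _ = _ := by ring

end Params

/-! ### Primitives and one-dimensional Sobolev estimates -/

section

variable {L : ℝ}

theorem prim_eq_intervalIntegral (h : L2I L) {x : ℝ} (hx : x ∈ Icc 0 L) :
    prim h x = ∫ t in (0 : ℝ)..x, h t := by
  have h1 : Ioc 0 x = Ioc 0 L ∩ Iic x := by rw [Ioc_inter_Iic, min_eq_right hx.2]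
  rw [prim, intervalIntegral.integral_of_le hx.1, h1]
  exact setIntegral_congr_set (Ioo_ae_eq_Ioc.inter (ae_eq_refl _))

/-- Cauchy–Schwarz against the indicator of `(-∞, x]`, whose norm in `L²(0, L)` is at most `√L`. -/
theorem norm_prim_le (hL : 0 < L) (h : L2I L) (x : ℝ) : ‖prim h x‖ ≤ √L * ‖h‖ := by
  have h1 := L2.inner_indicatorConstLp_one (𝕜 := ℂ) (μ := volume.restrict (Ioo 0 L))
    (measurableSet_Iic (a := x)) (measure_ne_top _ _) h
  rw [Measure.restrict_restrict measurableSet_Iic, inter_comm] at h1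
  rw [prim, ← h1]
  refine (norm_inner_le_norm _ _).trans (mul_le_mul_of_nonneg_right ?_ (norm_nonneg _))
  rw [norm_indicatorConstLp (by norm_num) (by norm_num), norm_one, one_mul, Real.sqrt_eq_rpow]
  have h2 : (volume.restrict (Ioo 0 L)).real (Iic x) ≤ L := by
    refine (measureReal_mono (subset_univ _)).trans (le_of_eq ?_)
    simp [hL.le]
  exact Real.rpow_le_rpow measureReal_nonneg h2 (by norm_num)

theorem norm_L2I_le_of_bound (hL : 0 < L) (u : L2I L) {C : ℝ} (hC : 0 ≤ C)
    (h : ∀ᵐ x ∂volume.restrict (Ioo 0 L), ‖u x‖ ≤ C) : ‖u‖ ≤ √L * C := by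
  refine (Lp.norm_le_of_ae_bound hC h).trans (le_of_eq ?_)
  congr 1
  simp [measureUnivNNReal, Real.sqrt_eq_rpow, ENNReal.coe_toNNReal_eq_toReal, hL.le]

/-- The class in `L²(0, L)` of a continuous function. -/
noncomputable def ofCont (L : ℝ) (w : ℝ → ℂ) (hw : Continuous w) : L2I L :=
  MemLp.toLp (p := 2) (μ := volume.restrict (Ioo 0 L)) w (by
    obtain ⟨C, hC⟩ := (isCompact_Icc (a := 0) (b := L)).exists_bound_of_continuousOn hw.continuousOn
    refine MemLp.of_bound hw.aestronglyMeasurable C ?_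
    filter_upwards [ae_restrict_mem measurableSet_Ioo] with x hx
    exact hC x (Ioo_subset_Icc_self hx))

theorem coeFn_ofCont {w : ℝ → ℂ} (hw : Continuous w) :
    ofCont L w hw =ᵐ[volume.restrict (Ioo 0 L)] w := MemLp.coeFn_toLp _

theorem isContRep_ofCont {w : ℝ → ℂ} (hw : Continuous w) : IsContRep (ofCont L w hw) w :=
  ⟨hw.continuousOn, coeFn_ofCont hw⟩

/-- The constant drops out because the derivative of a test function has integral zero; the
primitive is handled by `integral_deriv_smul_prim`. -/
theorem hasWeakDeriv_of_eq_prim {u h : L2I L} {w : ℝ → ℂ} (c : ℂ)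
    (huw : u =ᵐ[volume.restrict (Ioo 0 L)] w) (hw : ∀ x ∈ Icc 0 L, w x = c + prim h x) :
    HasWeakDeriv u h := by
  intro φ hφ
  have hd : Continuous (deriv φ) := hφ.smooth.continuous_deriv (by norm_num)
  have hdi : Integrable (deriv φ) (volume.restrict (Ioo 0 L)) :=
    (hd.integrable_of_hasCompactSupport hφ.compact.deriv).restrict
  have h1 : ∫ x in Ioo 0 L, deriv φ x • u x =
      ∫ x in Ioo 0 L, (deriv φ x • c + deriv φ x • prim h x) := by
    refine integral_congr_ae ?_
    filter_upwards [huw, ae_restrict_mem measurableSet_Ioo] with x hx hx'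
    rw [hx, hw x (Ioo_subset_Icc_self hx'), smul_add]
  have h2 : ∫ x in Ioo 0 L, deriv φ x = 0 := by
    rw [setIntegral_eq_integral_of_forall_compl_eq_zero fun x hx => ?_]
    · exact integral_of_hasDerivAt_of_tendsto
        (fun x => ((hφ.smooth.differentiable (by norm_num)) x).hasDerivAt)
        (hd.integrable_of_hasCompactSupport hφ.compact.deriv)
        (hφ.compact.is_zero_at_infty.mono_left atBot_le_cocompact)
        (hφ.compact.is_zero_at_infty.mono_left atTop_le_cocompact) |>.trans (sub_zero 0)
    · exact image_eq_zero_of_notMem_tsupport fun h' =>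
        hx (hφ.supp (tsupport_deriv_subset h'))
  rw [h1, integral_add (hdi.smul_const c) (integrable_smul_prim h hd hφ.compact.deriv),
    integral_smul_const, h2, zero_smul, zero_add, integral_deriv_smul_prim h hφ]

theorem prim_zero (h : L2I L) : prim h 0 = 0 := by
  have : Ioo 0 L ∩ Iic (0 : ℝ) = ∅ := by
    ext x; simp only [mem_inter_iff, mem_Ioo, mem_Iic, mem_empty_iff_false, iff_false]
    exact fun h => absurd h.1.1 (not_lt.2 h.2)
  rw [prim, this, Measure.restrict_empty, integral_zero_measure]

/-- The fundamental theorem of calculus in `H¹`. It gives the trace and Poincaré bounds, by which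
the energy norm controls `V` and `P` although it contains only their derivatives. -/
theorem val_eq_add_prim (hL : 0 < L) {u : L2I L} (hu : u ∈ H1 L) {x : ℝ} (hx : x ∈ Icc 0 L) :
    val u x = val u 0 + prim (wd u) x := by
  obtain ⟨c, hc⟩ := (hasWeakDeriv_wd hu).ae_eq_prim hL
  have h : IsContRep u fun x => c + prim (wd u) x :=
    ⟨(continuous_const.add (continuous_prim _)).continuousOn, hc⟩
  rw [val_eq hL h hx, val_eq hL h ⟨le_rfl, hL.le⟩, prim_zero, add_zero]

/-- An `H¹` function whose weak derivative has a continuous representative `w` is differentiable. -/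
theorem hasDerivWithinAt_val (hL : 0 < L) {u : L2I L} (hu : u ∈ H1 L) {w : ℝ → ℂ}
    (hw : IsContRep (wd u) w) {x : ℝ} (hx : x ∈ Icc 0 L) :
    HasDerivWithinAt (val u) (w x) (Icc 0 L) x := by
  have h1 : ∀ y ∈ Icc 0 L, val u y = val u 0 + ∫ t in (0 : ℝ)..y, w t := by
    intro y hy
    rw [val_eq_add_prim hL hu hy, prim_eq_intervalIntegral _ hy]
    congr 1
    refine intervalIntegral.integral_congr_ae_restrict ?_
    rw [uIoc_of_le hy.1, restrict_Ioo_eq_restrict_Ioc.symm]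
    exact ae_mono (Measure.restrict_mono (Ioo_subset_Ioo_right hy.2) le_rfl) hw.2
  have h2 : HasDerivWithinAt (fun y => ∫ t in (0 : ℝ)..y, w t) (w x) (Icc 0 L) x := by
    have : Fact (x ∈ Icc 0 L) := ⟨hx⟩
    refine intervalIntegral.integral_hasDerivWithinAt_right ?_ ?_ (hw.1 x hx)
    · refine (hw.1.mono ?_).intervalIntegrable
      rw [uIcc_of_le hx.1]
      exact Icc_subset_Icc_right hx.2
    · exact hw.1.stronglyMeasurableAtFilter_nhdsWithin measurableSet_Icc x
  exact ((h2.const_add (val u 0)).congr h1 (h1 x hx))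

theorem norm_val_le (hL : 0 < L) {u : L2I L} (hu : u ∈ H1 L) (h0 : val u 0 = 0) {x : ℝ}
    (hx : x ∈ Icc 0 L) : ‖val u x‖ ≤ √L * ‖wd u‖ := by
  rw [val_eq_add_prim hL hu hx, h0, zero_add]
  exact norm_prim_le hL _ _

theorem norm_le_wd (hL : 0 < L) {u : L2I L} (hu : u ∈ H1 L) (h0 : val u 0 = 0) :
    ‖u‖ ≤ L * ‖wd u‖ := by
  refine (norm_L2I_le_of_bound hL u (C := √L * ‖wd u‖) (by positivity) ?_).trans (le_of_eq ?_)
  · filter_upwards [(isContRep_val hL hu).2, ae_restrict_mem measurableSet_Ioo] with x hx hx'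
    rw [hx]
    exact norm_val_le hL hu h0 (Ioo_subset_Icc_self hx')
  · rw [← mul_assoc, Real.mul_self_sqrt hL.le]

end

/-! ### The diffusive equation on the line -/

namespace Params

variable (p : Params)

/-- The multiplier `ξ² + η + z`. -/
noncomputable def sym (z : ℂ) (ξ : ℝ) : ℂ := ((ξ ^ 2 + p.η : ℝ) : ℂ) + z

theorem sq_add_le_norm_sym {z : ℂ} (hz : z.re = 0) (ξ : ℝ) : ξ ^ 2 + p.η ≤ ‖p.sym z ξ‖ := by
  have h := Complex.re_le_norm (p.sym z ξ)
  rwa [sym, Complex.add_re, Complex.ofReal_re, hz, add_zero] at h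

theorem η_le_norm_sym {z : ℂ} (hz : z.re = 0) (ξ : ℝ) : p.η ≤ ‖p.sym z ξ‖ :=
  (le_add_of_nonneg_left (sq_nonneg ξ)).trans (p.sq_add_le_norm_sym hz ξ)

theorem sym_ne_zero {z : ℂ} (hz : z.re = 0) (ξ : ℝ) : p.sym z ξ ≠ 0 :=
  norm_pos_iff.1 (p.hη.trans_le (p.η_le_norm_sym hz ξ))

theorem measurable_sym (z : ℂ) : Measurable (p.sym z) := by
  unfold sym; fun_prop

theorem measurable_wt : Measurable p.wt := by
  unfold wt; fun_prop

theorem wt_nonneg (ξ : ℝ) : 0 ≤ p.wt ξ := Real.rpow_nonneg (abs_nonneg _) _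

theorem wt_pos {ξ : ℝ} (hξ : 0 < ξ) : 0 < p.wt ξ := Real.rpow_pos_of_pos (abs_pos.2 hξ.ne') _

/-- The weight `m` is not in `L²`, but `m / (1 + |ξ|)` is. Quadratic growth of the multiplier pays
for one factor `1 + |ξ|` there and for another in the requirement `|ξ|φ ∈ L²`. -/
theorem exists_one_add_sq_le {z : ℂ} (hz : z.re = 0) :
    ∃ C, 0 ≤ C ∧ ∀ ξ : ℝ, (1 + |ξ|) ^ 2 ≤ C * ‖p.sym z ξ‖ := by
  have hη := p.hη
  refine ⟨2 + 2 / p.η, by positivity, fun ξ => ?_⟩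
  calc (1 + |ξ|) ^ 2 ≤ 2 * ξ ^ 2 + 2 := by nlinarith [sq_abs ξ, sq_nonneg (1 - |ξ|)]
    _ ≤ (2 + 2 / p.η) * (ξ ^ 2 + p.η) := by
        have : (2 + 2 / p.η) * (ξ ^ 2 + p.η) = 2 * ξ ^ 2 + 2 + (2 * p.η + 2 / p.η * ξ ^ 2) := by
          field_simp; ring
        rw [this]; exact le_add_of_nonneg_right (by positivity)
    _ ≤ _ := by gcongr; exact p.sq_add_le_norm_sym hz ξ

/-- Both `m / (ξ² + η + z)` and `|ξ| m / (ξ² + η + z)` are dominated by `m / (1 + |ξ|)`. -/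
theorem exists_wt_div_sym_le {z : ℂ} (hz : z.re = 0) : ∃ C, ∀ ξ : ℝ,
    ‖(p.wt ξ : ℂ) / p.sym z ξ‖ ≤ C * ‖p.wt ξ / (1 + |ξ|)‖ ∧
    ‖((|ξ| : ℝ) : ℂ) * ((p.wt ξ : ℂ) / p.sym z ξ)‖ ≤ C * ‖p.wt ξ / (1 + |ξ|)‖ := by
  obtain ⟨C, hC, h⟩ := p.exists_one_add_sq_le hz
  have key : ∀ ξ : ℝ, (1 + |ξ|) * ‖(p.wt ξ : ℂ) / p.sym z ξ‖ ≤ C * ‖p.wt ξ / (1 + |ξ|)‖ := by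
    intro ξ
    have h0 : 0 < 1 + |ξ| := by positivity
    have hw := p.wt_nonneg ξ
    have hs := norm_pos_iff.2 (p.sym_ne_zero hz ξ)
    rw [norm_div, Complex.norm_real, norm_div, Real.norm_of_nonneg hw, Real.norm_of_nonneg h0.le,
      ← mul_div_assoc, ← mul_div_assoc, div_le_div_iff₀ hs h0]
    calc (1 + |ξ|) * p.wt ξ * (1 + |ξ|) = p.wt ξ * (1 + |ξ|) ^ 2 := by ring
      _ ≤ p.wt ξ * (C * ‖p.sym z ξ‖) := mul_le_mul_of_nonneg_left (h ξ) hw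
      _ = _ := by ring
  refine ⟨C, fun ξ => ⟨le_trans ?_ (key ξ), le_trans ?_ (key ξ)⟩⟩
  · exact le_mul_of_one_le_left (norm_nonneg _) (by linarith [abs_nonneg ξ])
  · rw [norm_mul, Complex.norm_real, Real.norm_of_nonneg (abs_nonneg ξ)]
    exact mul_le_mul_of_nonneg_right (by linarith) (norm_nonneg _)

theorem memLp_wt_div_sym {z : ℂ} (hz : z.re = 0) :
    MemLp (fun ξ => (p.wt ξ : ℂ) / p.sym z ξ) 2 volume := by
  obtain ⟨C, hC⟩ := p.exists_wt_div_sym_le hz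
  refine MemLp.of_le_mul p.memLp_wt_div ?_ (Filter.Eventually.of_forall fun ξ => (hC ξ).1)
  exact ((Complex.measurable_ofReal.comp p.measurable_wt).div (p.measurable_sym z)).aestronglyMeasurable

theorem memLp_abs_mul_wt_div_sym {z : ℂ} (hz : z.re = 0) :
    MemLp (fun ξ => ((|ξ| : ℝ) : ℂ) * ((p.wt ξ : ℂ) / p.sym z ξ)) 2 volume := by
  obtain ⟨C, hC⟩ := p.exists_wt_div_sym_le hz
  refine MemLp.of_le_mul p.memLp_wt_div ?_ (Filter.Eventually.of_forall fun ξ => (hC ξ).2)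
  exact ((Complex.measurable_ofReal.comp measurable_id.abs).mul
    ((Complex.measurable_ofReal.comp p.measurable_wt).div (p.measurable_sym z))).aestronglyMeasurable

/-- The element `m / (ξ² + η + z)` of `L²(ℝ)`. -/
noncomputable def ker {z : ℂ} (hz : z.re = 0) : L2R := (p.memLp_wt_div_sym hz).toLp _

theorem coeFn_ker {z : ℂ} (hz : z.re = 0) :
    p.ker hz =ᵐ[volume] fun ξ => (p.wt ξ : ℂ) / p.sym z ξ := MemLp.coeFn_toLp _

theorem absMul_ker {z : ℂ} (hz : z.re = 0) : MemLp (absMul (p.ker hz)) 2 volume := by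
  refine (memLp_congr_ae ?_).2 (p.memLp_abs_mul_wt_div_sym hz)
  filter_upwards [p.coeFn_ker hz] with ξ h
  rw [absMul, h]

theorem norm_div_sym_le {z : ℂ} (hz : z.re = 0) (F : L2R) (ξ : ℝ) :
    ‖F ξ / p.sym z ξ‖ ≤ p.η⁻¹ * ‖F ξ‖ := by
  rw [norm_div, div_eq_inv_mul]
  exact mul_le_mul_of_nonneg_right (inv_anti₀ p.hη (p.η_le_norm_sym hz ξ)) (norm_nonneg _)

theorem aestronglyMeasurable_div_sym (z : ℂ) (F : L2R) :
    AEStronglyMeasurable (fun ξ => F ξ / p.sym z ξ) volume :=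
  ((Lp.stronglyMeasurable F).measurable.div (p.measurable_sym z)).aestronglyMeasurable

/-- The element `F / (ξ² + η + z)` of `L²(ℝ)`. -/
noncomputable def divSym {z : ℂ} (hz : z.re = 0) (F : L2R) : L2R :=
  MemLp.toLp (fun ξ => F ξ / p.sym z ξ) (MemLp.of_le_mul (Lp.memLp F)
    (p.aestronglyMeasurable_div_sym z F) (Filter.Eventually.of_forall (p.norm_div_sym_le hz F)))

theorem coeFn_divSym {z : ℂ} (hz : z.re = 0) (F : L2R) :
    p.divSym hz F =ᵐ[volume] fun ξ => F ξ / p.sym z ξ := MemLp.coeFn_toLp _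

theorem norm_divSym_le {z : ℂ} (hz : z.re = 0) (F : L2R) : ‖p.divSym hz F‖ ≤ p.η⁻¹ * ‖F‖ := by
  refine Lp.norm_le_mul_norm_of_ae_le_mul ?_
  filter_upwards [p.coeFn_divSym hz F] with ξ h
  rw [h]; exact p.norm_div_sym_le hz F ξ

theorem absMul_divSym {z : ℂ} (hz : z.re = 0) (F : L2R) :
    MemLp (absMul (p.divSym hz F)) 2 volume := by
  obtain ⟨C, hC, h⟩ := p.exists_one_add_sq_le hz
  refine MemLp.of_le_mul (c := C) (Lp.memLp F) ?_ ?_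
  · exact (Complex.measurable_ofReal.comp measurable_id.abs).aestronglyMeasurable.mul
      (Lp.aestronglyMeasurable _)
  · filter_upwards [p.coeFn_divSym hz F] with ξ hξ
    have hs := norm_pos_iff.2 (p.sym_ne_zero hz ξ)
    rw [absMul, hξ, norm_mul, norm_div, Complex.norm_real, Real.norm_of_nonneg (abs_nonneg ξ),
      ← mul_div_assoc, div_le_iff₀ hs]
    have h1 : |ξ| ≤ C * ‖p.sym z ξ‖ := le_trans (by nlinarith [abs_nonneg ξ]) (h ξ)
    calc |ξ| * ‖F ξ‖ ≤ C * ‖p.sym z ξ‖ * ‖F ξ‖ := by gcongr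
      _ = _ := by ring

/-- The output integrates against `m`, which is not square integrable. After division by the
multiplier, the denominator can be moved from `F` to `m`, and Cauchy–Schwarz applies to `ker`. -/
theorem norm_output_divSym_le {z : ℂ} (hz : z.re = 0) (F : L2R) :
    ‖p.output (p.divSym hz F)‖ ≤ p.κ * (‖p.ker hz‖ * ‖F‖) := by
  rw [output, norm_mul, Complex.norm_real, Real.norm_of_nonneg p.κ_pos.le]
  refine mul_le_mul_of_nonneg_left ?_ p.κ_pos.le
  have h1 : ∫ ξ, (p.wt ξ : ℂ) * p.divSym hz F ξ = inner ℂ (star (p.ker hz)) F := by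
    rw [L2.inner_def]
    refine integral_congr_ae ?_
    filter_upwards [p.coeFn_divSym hz F, p.coeFn_ker hz, Lp.coeFn_star (p.ker hz)] with ξ h1 h2 h3
    rw [h1, h3, Pi.star_apply, h2, RCLike.inner_apply, ← starRingEnd_apply, Complex.conj_conj]
    ring
  rw [h1]
  refine (norm_inner_le_norm _ _).trans (mul_le_mul_of_nonneg_right ?_ (norm_nonneg _))
  refine Lp.norm_le_norm_of_ae_le ?_
  filter_upwards [Lp.coeFn_star (p.ker hz)] with ξ h
  rw [h, Pi.star_apply, norm_star]

/-- The real part of the integrand is `m² (ξ² + η) / |ξ² + η + z|²`, which is positive away from the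
origin. This is the dissipation that makes the boundary condition absorbing. -/
theorem output_ker_re_pos {z : ℂ} (hz : z.re = 0) : 0 < (p.output (p.ker hz)).re := by
  rw [output, Complex.re_ofReal_mul]
  refine mul_pos p.κ_pos ?_
  have hi := p.integrable_wt_mul (p.absMul_ker hz)
  have h1 : (∫ ξ, (p.wt ξ : ℂ) * p.ker hz ξ).re = ∫ ξ, ((p.wt ξ : ℂ) * p.ker hz ξ).re :=
    (integral_re hi).symm
  have h2 : (fun ξ => ((p.wt ξ : ℂ) * p.ker hz ξ).re) =ᵐ[volume]
      fun ξ => p.wt ξ ^ 2 * (ξ ^ 2 + p.η) / Complex.normSq (p.sym z ξ) := by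
    filter_upwards [p.coeFn_ker hz] with ξ h
    rw [h, Complex.re_ofReal_mul, Complex.div_re, Complex.ofReal_re, Complex.ofReal_im]
    have : (p.sym z ξ).re = ξ ^ 2 + p.η := by
      rw [sym, Complex.add_re, Complex.ofReal_re, hz, add_zero]
    rw [this]; ring
  have hη := p.hη
  rw [h1, integral_congr_ae h2, integral_pos_iff_support_of_nonneg]
  -- A half-line already has positive measure, and it avoids `ξ = 0`, where `m` may vanish.
  · refine lt_of_lt_of_le (?_ : 0 < volume (Ioi (0 : ℝ))) (measure_mono fun ξ hξ => ?_)
    · simp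
    · have h3 := p.wt_pos hξ
      have h4 := Complex.normSq_pos.2 (p.sym_ne_zero hz ξ)
      exact (by positivity : 0 < p.wt ξ ^ 2 * (ξ ^ 2 + p.η) / Complex.normSq (p.sym z ξ)).ne'
  · intro ξ
    have h4 := Complex.normSq_nonneg (p.sym z ξ)
    change 0 ≤ p.wt ξ ^ 2 * (ξ ^ 2 + p.η) / Complex.normSq (p.sym z ξ)
    positivity
  · exact (integrable_congr h2).1 hi.re

/-- The solution `(F + b m) / (ξ² + η + z)` of the diffusive equation. -/
noncomputable def diffSol {z : ℂ} (hz : z.re = 0) (F : L2R) (b : ℂ) : L2R :=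
  p.divSym hz F + b • p.ker hz

theorem coeFn_diffSol {z : ℂ} (hz : z.re = 0) (F : L2R) (b : ℂ) :
    p.diffSol hz F b =ᵐ[volume] fun ξ => (F ξ + b * (p.wt ξ : ℂ)) / p.sym z ξ := by
  filter_upwards [p.coeFn_divSym hz F, p.coeFn_ker hz, Lp.coeFn_add (p.divSym hz F) (b • p.ker hz),
    Lp.coeFn_smul b (p.ker hz)] with ξ h1 h2 h3 h4
  rw [diffSol, h3, Pi.add_apply, h4, Pi.smul_apply, h1, h2, smul_eq_mul]
  ring

theorem absMul_diffSol {z : ℂ} (hz : z.re = 0) (F : L2R) (b : ℂ) :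
    MemLp (absMul (p.diffSol hz F b)) 2 volume :=
  (memLp_congr_ae (absMul_add _ _)).2 ((p.absMul_divSym hz F).add
    ((memLp_congr_ae (absMul_smul _ _)).2 ((p.absMul_ker hz).const_smul b)))

/-- Besides solving the equation, this shows that the diffusive component lies in `L²`, a domain
condition not evident from its two separate terms. -/
theorem diffusive_diffSol {z : ℂ} (hz : z.re = 0) (F : L2R) (b : ℂ) :
    p.diffusive (p.diffSol hz F b) b =ᵐ[volume] (z • p.diffSol hz F b - F : L2R) := by
  filter_upwards [p.coeFn_diffSol hz F b, Lp.coeFn_sub (z • p.diffSol hz F b) F,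
    Lp.coeFn_smul z (p.diffSol hz F b)] with ξ h1 h2 h3
  rw [h2, Pi.sub_apply, h3, Pi.smul_apply, diffusive, h1, smul_eq_mul]
  have h := p.sym_ne_zero hz ξ
  have e : ((ξ ^ 2 + p.η : ℝ) : ℂ) = p.sym z ξ - z := by rw [sym]; ring
  rw [e]
  field_simp
  ring

theorem output_diffSol {z : ℂ} (hz : z.re = 0) (F : L2R) (b : ℂ) :
    p.output (p.diffSol hz F b) = p.output (p.divSym hz F) + b * p.output (p.ker hz) := by
  rw [diffSol, p.output_add (p.absMul_divSym hz F)
    ((memLp_congr_ae (absMul_smul _ _)).2 ((p.absMul_ker hz).const_smul b)), output_smul]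

theorem eq_smul_ker {z : ℂ} (hz : z.re = 0) {φ : L2R} {b : ℂ}
    (h : p.diffusive φ b =ᵐ[volume] (z • φ : L2R)) : φ = b • p.ker hz := by
  refine Lp.ext ?_
  filter_upwards [h, Lp.coeFn_smul z φ, Lp.coeFn_smul b (p.ker hz), p.coeFn_ker hz]
    with ξ h1 h2 h3 h4
  rw [h3, Pi.smul_apply, h4, smul_eq_mul, mul_div_assoc', eq_div_iff (p.sym_ne_zero hz ξ), sym]
  rw [h2, Pi.smul_apply, smul_eq_mul, diffusive] at h1
  linear_combination -h1

end Params

/-! ### From integral equations to weak derivatives -/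

section

variable {L : ℝ}

theorem prim_add (h k : L2I L) (x : ℝ) : prim (h + k) x = prim h x + prim k x := by
  rw [prim, prim, prim, ← integral_add ((integrableOn_L2I h).mono_set inter_subset_left)
    ((integrableOn_L2I k).mono_set inter_subset_left)]
  exact integral_congr_ae (ae_mono (Measure.restrict_mono inter_subset_left le_rfl)
    (Lp.coeFn_add h k))

/-- Reads a component of the Volterra equation as a weak derivative: `w'` is the continuous part
coming from the system, and `k` is the `L²` load, present only through its primitive. -/
theorem hasWeakDeriv_of_integral {u h k : L2I L} {w w' : ℝ → ℂ} (c : ℂ)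
    (hu : u =ᵐ[volume.restrict (Ioo 0 L)] w) (hh : h =ᵐ[volume.restrict (Ioo 0 L)] w')
    (hw : ∀ x ∈ Icc 0 L, w x = c + prim k x + ∫ t in (0 : ℝ)..x, w' t) :
    HasWeakDeriv u (h + k) := by
  refine hasWeakDeriv_of_eq_prim c hu fun x hx => ?_
  have : prim h x = ∫ t in (0 : ℝ)..x, w' t := by
    rw [prim_eq_intervalIntegral _ hx]
    refine intervalIntegral.integral_congr_ae_restrict ?_
    rw [uIoc_of_le hx.1, restrict_Ioo_eq_restrict_Ioc.symm]
    exact ae_mono (Measure.restrict_mono (Ioo_subset_Ioo_right hx.2) le_rfl) hh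
  rw [hw x hx, prim_add, this]; ring

theorem norm_ofCont_le (hL : 0 < L) {w : ℝ → ℂ} (hw : Continuous w) {C : ℝ} (hC : 0 ≤ C)
    (h : ∀ x ∈ Icc 0 L, ‖w x‖ ≤ C) : ‖ofCont L w hw‖ ≤ √L * C := by
  refine norm_L2I_le_of_bound hL _ hC ?_
  filter_upwards [coeFn_ofCont hw, ae_restrict_mem measurableSet_Ioo] with x hx hx'
  rw [hx]; exact h x (Ioo_subset_Icc_self hx')

theorem val_sub (hL : 0 < L) {u v : L2I L} (hu : u ∈ H1 L) (hv : v ∈ H1 L) {x : ℝ}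
    (hx : x ∈ Icc 0 L) : val (u - v) x = val u x - val v x := by
  have h : u - v = u + (-1 : ℂ) • v := by rw [neg_one_smul, sub_eq_add_neg]
  rw [h, val_add hL hu (Submodule.smul_mem _ _ hv) hx, val_smul hL _ hv hx]; ring

theorem wd_sub {u v : L2I L} (hu : u ∈ H1 L) (hv : v ∈ H1 L) : wd (u - v) = wd u - wd v := by
  have h : u - v = u + (-1 : ℂ) • v := by rw [neg_one_smul, sub_eq_add_neg]
  rw [h, wd_add hu (Submodule.smul_mem _ _ hv), wd_smul _ hv, neg_one_smul, ← sub_eq_add_neg]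

theorem eq_zero_of_val_eq_zero (hL : 0 < L) {u : L2I L} (hu : u ∈ H1 L)
    (h : ∀ x ∈ Icc 0 L, val u x = 0) : u = 0 := by
  refine Lp.ext ?_
  filter_upwards [(isContRep_val hL hu).2, Lp.coeFn_zero ℂ 2 (volume.restrict (Ioo 0 L)),
    ae_restrict_mem measurableSet_Ioo] with x h1 h2 h3
  rw [h1, h2, h x (Ioo_subset_Icc_self h3)]; rfl

end

/-! ### The energy norm and its components -/

namespace Params

variable (p : Params)

theorem norm_sq_state (U : p.State) : ‖U‖ ^ 2 =
    p.ρ * ‖U.f‖ ^ 2 + p.μ * ‖U.g‖ ^ 2 + p.α₁ * ‖U.Vx‖ ^ 2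
      + p.β * ‖(p.γ : ℂ) • U.Vx - U.Px‖ ^ 2
      + p.κ * (p.l₁ * ‖U.φ₁‖ ^ 2 + p.l₂ * ‖U.φ₂‖ ^ 2) := by
  rw [norm_sq_eq_re_inner (𝕜 := ℂ) U]
  have h : inner ℂ U U = State.energyInner U U := rfl
  rw [h, State.energyInner_self, RCLike.re_to_complex, Complex.ofReal_re]

theorem le_of_mul_sq_le {c x N : ℝ} (hc : 0 < c) (hx : 0 ≤ x) (hN : 0 ≤ N)
    (h : c * x ^ 2 ≤ N ^ 2) : x ≤ (√c)⁻¹ * N := by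
  have hs := Real.sqrt_pos.2 hc
  rw [← div_eq_inv_mul, le_div_iff₀ hs]
  refine (sq_le_sq₀ (by positivity) hN).1 ?_
  rw [mul_pow, Real.sq_sqrt hc.le]; linarith

/-- The components of a state are bounded by its energy norm. -/
theorem exists_norm_components_le : ∃ K, 0 ≤ K ∧ ∀ U : p.State,
    ‖U.f‖ ≤ K * ‖U‖ ∧ ‖U.g‖ ≤ K * ‖U‖ ∧ ‖U.Vx‖ ≤ K * ‖U‖ ∧ ‖U.Px‖ ≤ K * ‖U‖ ∧
      ‖U.φ₁‖ ≤ K * ‖U‖ ∧ ‖U.φ₂‖ ≤ K * ‖U‖ := by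
  have hρ := p.hρ; have hμ := p.hμ; have hα₁ := p.hα₁; have hβ := p.hβ
  have hl₁ := mul_pos p.κ_pos p.hl₁; have hl₂ := mul_pos p.κ_pos p.hl₂
  set k₁ := (√p.ρ)⁻¹ with hk₁
  set k₂ := (√p.μ)⁻¹ with hk₂
  set k₃ := (√p.α₁)⁻¹ with hk₃
  set k₄ := (√p.β)⁻¹ with hk₄
  set k₅ := (√(p.κ * p.l₁))⁻¹ with hk₅
  set k₆ := (√(p.κ * p.l₂))⁻¹ with hk₆
  have n₁ : 0 ≤ k₁ := by positivity
  have n₂ : 0 ≤ k₂ := by positivity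
  have n₃ : 0 ≤ k₃ := by positivity
  have n₄ : 0 ≤ k₄ := by positivity
  have n₅ : 0 ≤ k₅ := by positivity
  have n₆ : 0 ≤ k₆ := by positivity
  have n₇ : 0 ≤ |p.γ| * k₃ := by positivity
  refine ⟨k₁ + k₂ + k₃ + k₄ + k₅ + k₆ + |p.γ| * k₃, by positivity, fun U => ?_⟩
  have hU := p.norm_sq_state U
  have a1 : 0 ≤ p.ρ * ‖U.f‖ ^ 2 := by positivity
  have a2 : 0 ≤ p.μ * ‖U.g‖ ^ 2 := by positivity
  have a3 : 0 ≤ p.α₁ * ‖U.Vx‖ ^ 2 := by positivity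
  have a4 : 0 ≤ p.β * ‖(p.γ : ℂ) • U.Vx - U.Px‖ ^ 2 := by positivity
  have a5 : 0 ≤ p.κ * p.l₁ * ‖U.φ₁‖ ^ 2 := by positivity
  have a6 : 0 ≤ p.κ * p.l₂ * ‖U.φ₂‖ ^ 2 := by positivity
  have e1 := le_of_mul_sq_le hρ (norm_nonneg U.f) (norm_nonneg U) (by linarith)
  have e2 := le_of_mul_sq_le hμ (norm_nonneg U.g) (norm_nonneg U) (by linarith)
  have e3 := le_of_mul_sq_le hα₁ (norm_nonneg U.Vx) (norm_nonneg U) (by linarith)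
  have e4 := le_of_mul_sq_le hβ (norm_nonneg ((p.γ : ℂ) • U.Vx - U.Px)) (norm_nonneg U)
    (by linarith)
  have e5 := le_of_mul_sq_le hl₁ (norm_nonneg U.φ₁) (norm_nonneg U) (by linarith)
  have e6 := le_of_mul_sq_le hl₂ (norm_nonneg U.φ₂) (norm_nonneg U) (by linarith)
  -- The energy sees `P_x` only through `γV_x - P_x`, so it is recovered using the bound on `V_x`.
  have e7 : ‖U.Px‖ ≤ (|p.γ| * k₃ + k₄) * ‖U‖ := by
    have h1 : U.Px = (p.γ : ℂ) • U.Vx - ((p.γ : ℂ) • U.Vx - U.Px) := by abel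
    rw [h1]
    refine (norm_sub_le _ _).trans ?_
    rw [norm_smul, Complex.norm_real, Real.norm_eq_abs, add_mul, mul_assoc]
    exact add_le_add (mul_le_mul_of_nonneg_left e3 (abs_nonneg _)) e4
  have key : ∀ {x k : ℝ}, x ≤ k * ‖U‖ → k ≤ k₁ + k₂ + k₃ + k₄ + k₅ + k₆ + |p.γ| * k₃ →
      x ≤ (k₁ + k₂ + k₃ + k₄ + k₅ + k₆ + |p.γ| * k₃) * ‖U‖ := fun h h' =>
    h.trans (mul_le_mul_of_nonneg_right h' (norm_nonneg _))
  exact ⟨key e1 (by linarith), key e2 (by linarith), key e3 (by linarith), key e7 (by linarith),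
    key e5 (by linarith), key e6 (by linarith)⟩

/-- The energy norm is bounded by the norms of the components. -/
theorem exists_norm_le_components : ∃ K, 0 ≤ K ∧ ∀ U : p.State,
    ‖U‖ ≤ K * (‖U.f‖ + ‖U.g‖ + ‖U.Vx‖ + ‖U.Px‖ + ‖U.φ₁‖ + ‖U.φ₂‖) := by
  have hρ := p.hρ; have hμ := p.hμ; have hα₁ := p.hα₁; have hβ := p.hβ
  have hκ := p.κ_pos; have hl₁ := p.hl₁; have hl₂ := p.hl₂
  refine ⟨√(p.ρ + p.μ + p.α₁ + p.β * (|p.γ| + 1) ^ 2 + p.κ * (p.l₁ + p.l₂)), by positivity,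
    fun U => ?_⟩
  set S := ‖U.f‖ + ‖U.g‖ + ‖U.Vx‖ + ‖U.Px‖ + ‖U.φ₁‖ + ‖U.φ₂‖ with hS
  have n1 := norm_nonneg U.f
  have n2 := norm_nonneg U.g
  have n3 := norm_nonneg U.Vx
  have n4 := norm_nonneg U.Px
  have n5 := norm_nonneg U.φ₁
  have n6 := norm_nonneg U.φ₂
  have hS0 : 0 ≤ S := by positivity
  have e4 : ‖(p.γ : ℂ) • U.Vx - U.Px‖ ≤ (|p.γ| + 1) * S := by
    refine (norm_sub_le _ _).trans ?_
    rw [norm_smul, Complex.norm_real, Real.norm_eq_abs, add_mul, one_mul]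
    exact add_le_add (mul_le_mul_of_nonneg_left (by linarith) (abs_nonneg _)) (by linarith)
  refine (sq_le_sq₀ (norm_nonneg _) (by positivity)).1 ?_
  rw [mul_pow, Real.sq_sqrt (by positivity), p.norm_sq_state]
  have b1 : p.ρ * ‖U.f‖ ^ 2 ≤ p.ρ * S ^ 2 := by gcongr; linarith
  have b2 : p.μ * ‖U.g‖ ^ 2 ≤ p.μ * S ^ 2 := by gcongr; linarith
  have b3 : p.α₁ * ‖U.Vx‖ ^ 2 ≤ p.α₁ * S ^ 2 := by gcongr; linarith
  have b4 : p.β * ‖(p.γ : ℂ) • U.Vx - U.Px‖ ^ 2 ≤ p.β * ((|p.γ| + 1) * S) ^ 2 := by gcongr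
  have b5 : p.κ * (p.l₁ * ‖U.φ₁‖ ^ 2 + p.l₂ * ‖U.φ₂‖ ^ 2) ≤ p.κ * (p.l₁ * S ^ 2 + p.l₂ * S ^ 2) := by
    gcongr <;> linarith
  linarith [b1, b2, b3, b4, b5]

/-! ### Injectivity of the resolvent equation -/

theorem re_gain_mul_output_ker_pos {z : ℂ} (hz : z.re = 0) {l : ℝ} (hl : 0 < l) :
    0 < ((l : ℂ) * p.output (p.ker hz)).re := by
  rw [Complex.re_ofReal_mul]
  exact mul_pos hl (p.output_ker_re_pos hz)

/-- `z - A` is injective on `D(A)` for purely imaginary `z`. -/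
theorem eq_zero_of_smul_eq_act {z : ℂ} (hz : z.re = 0) {U : p.State} (hU : p.InDomain U)
    (h : z • U = p.act U hU) : U = 0 := by
  have hL := p.hL
  have hρ : (p.ρ : ℂ) ≠ 0 := by exact_mod_cast p.hρ.ne'
  have hμ : (p.μ : ℂ) ≠ 0 := by exact_mod_cast p.hμ.ne'
  have hα₁ : (p.α₁ : ℂ) ≠ 0 := by exact_mod_cast p.hα₁.ne'
  have hβ : (p.β : ℂ) ≠ 0 := by exact_mod_cast p.hβ.ne'
  have hα : (p.α : ℂ) = p.α₁ + p.γ ^ 2 * p.β := by rw [α]; push_cast; ring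
  have h1 : U.f = z • U.V := (congrArg State.V h).symm
  have h2 : z • U.f = ((p.α / p.ρ : ℝ) : ℂ) • wd U.Vx - ((p.γ * p.β / p.ρ : ℝ) : ℂ) • wd U.Px :=
    congrArg State.f h
  have h3 : z • U.φ₁ = hU.diff_φ₁.toLp _ := congrArg State.φ₁ h
  have h4 : U.g = z • U.P := (congrArg State.P h).symm
  have h5 : z • U.g = -((p.γ * p.β / p.μ : ℝ) : ℂ) • wd U.Vx + ((p.β / p.μ : ℝ) : ℂ) • wd U.Px :=
    congrArg State.g h
  have h6 : z • U.φ₂ = hU.diff_φ₂.toLp _ := congrArg State.φ₂ h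
  have hφ₁ : U.φ₁ = val U.f p.L • p.ker hz := p.eq_smul_ker hz (by
    rw [h3]; exact (MemLp.coeFn_toLp hU.diff_φ₁).symm)
  have hφ₂ : U.φ₂ = val U.g p.L • p.ker hz := p.eq_smul_ker hz (by
    rw [h6]; exact (MemLp.coeFn_toLp hU.diff_φ₂).symm)
  set S₁ : L2I p.L := (p.α : ℂ) • U.Vx - ((p.γ : ℂ) * p.β) • U.Px with hS₁
  set S₂ : L2I p.L := (p.β : ℂ) • U.Px - ((p.γ : ℂ) * p.β) • U.Vx with hS₂
  have hVx := hU.Vx_mem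
  have hPx := hU.Px_mem
  have m₁ : S₁ ∈ H1 p.L := sub_mem (Submodule.smul_mem _ _ hVx) (Submodule.smul_mem _ _ hPx)
  have m₂ : S₂ ∈ H1 p.L := sub_mem (Submodule.smul_mem _ _ hPx) (Submodule.smul_mem _ _ hVx)
  have v₁ : ∀ x ∈ Icc 0 p.L, val S₁ x = p.α * val U.Vx x - p.γ * p.β * val U.Px x := by
    intro x hx
    rw [hS₁, val_sub hL (Submodule.smul_mem _ _ hVx) (Submodule.smul_mem _ _ hPx) hx,
      val_smul hL _ hVx hx, val_smul hL _ hPx hx]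
  have v₂ : ∀ x ∈ Icc 0 p.L, val S₂ x = p.β * val U.Px x - p.γ * p.β * val U.Vx x := by
    intro x hx
    rw [hS₂, val_sub hL (Submodule.smul_mem _ _ hPx) (Submodule.smul_mem _ _ hVx) hx,
      val_smul hL _ hPx hx, val_smul hL _ hVx hx]
  -- The stress has a multiple of `V` as weak derivative, which is continuous; this upgrades the
  -- weak equation to a classical ODE.
  have w₁ : wd S₁ = ((p.ρ : ℂ) * z ^ 2) • U.V := by
    rw [hS₁, wd_sub (Submodule.smul_mem _ _ hVx) (Submodule.smul_mem _ _ hPx), wd_smul _ hVx,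
      wd_smul _ hPx]
    have e : ((p.ρ : ℂ) * z ^ 2) • U.V = (p.ρ : ℂ) • z • U.f := by rw [h1]; module
    rw [e, h2]
    push_cast
    match_scalars <;> field_simp
  have w₂ : wd S₂ = ((p.μ : ℂ) * z ^ 2) • U.P := by
    rw [hS₂, wd_sub (Submodule.smul_mem _ _ hPx) (Submodule.smul_mem _ _ hVx), wd_smul _ hPx,
      wd_smul _ hVx]
    have e : ((p.μ : ℂ) * z ^ 2) • U.P = (p.μ : ℂ) • z • U.g := by rw [h4]; module
    rw [e, h5]
    push_cast
    match_scalars <;> field_simp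
  have crep : ∀ (c : ℂ) {u : L2I p.L}, u ∈ H1 p.L → IsContRep (c • u) fun x => c * val u x := by
    intro c u hu
    have h1 := isContRep_val hL hu
    refine ⟨continuousOn_const.mul h1.1, ?_⟩
    filter_upwards [h1.2, Lp.coeFn_smul c u] with x e1 e3
    rw [e3, Pi.smul_apply, e1, smul_eq_mul]
  -- With `φ₁ = f(L) ker`, `φ₂ = g(L) ker`, `f = zV` and `g = zP`, the feedback conditions become
  -- absorbing ones with coefficients `l₁k` and `l₂k`, `k` being the output of `ker`.
  have hY := p.eq_zero_of_homogeneous hz (p.re_gain_mul_output_ker_pos hz p.hl₁)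
    (p.re_gain_mul_output_ker_pos hz p.hl₂)
    (Y := fun x => (val U.V x, val U.P x, val S₁ x, val S₂ x)) ?_ U.hV.2 U.hP.2 ?_ ?_
  · have hV0 : U.V = 0 := eq_zero_of_val_eq_zero hL U.hV.1 fun x hx => congrArg Prod.fst (hY x hx)
    have hP0 : U.P = 0 := eq_zero_of_val_eq_zero hL U.hP.1 fun x hx =>
      congrArg (fun y : Phase => y.2.1) (hY x hx)
    have hf0 : U.f = 0 := by rw [h1, hV0, smul_zero]
    have hg0 : U.g = 0 := by rw [h4, hP0, smul_zero]
    refine State.ext hV0 hf0 ?_ hP0 hg0 ?_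
    · rw [hφ₁, hf0, val_zero hL p.L_mem_Icc, zero_smul]; rfl
    · rw [hφ₂, hg0, val_zero hL p.L_mem_Icc, zero_smul]; rfl
  · intro x hx
    have d1 : HasDerivWithinAt (val U.V) (val U.Vx x) _ _ := hasDerivWithinAt_val hL U.hV.1 (isContRep_val hL hVx) hx
    have d2 : HasDerivWithinAt (val U.P) (val U.Px x) _ _ := hasDerivWithinAt_val hL U.hP.1 (isContRep_val hL hPx) hx
    have d3 := hasDerivWithinAt_val hL m₁ (w₁ ▸ crep _ U.hV.1) hx
    have d4 := hasDerivWithinAt_val hL m₂ (w₂ ▸ crep _ U.hP.1) hx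
    refine (d1.prodMk (d2.prodMk (d3.prodMk d4))).congr_deriv ?_
    rw [sysMat_apply]
    simp only [v₁ x hx, v₂ x hx, hα]
    refine Prod.ext ?_ (Prod.ext ?_ rfl)
    · field_simp; ring
    · field_simp; ring
  · have hb := hU.bdry_V
    have hf : val U.f p.L = z * val U.V p.L := by rw [h1, val_smul hL _ U.hV.1 p.L_mem_Icc]
    rw [hφ₁, output_smul, hf] at hb
    simp only [v₁ _ p.L_mem_Icc]
    linear_combination hb
  · have hb := hU.bdry_P
    have hg : val U.g p.L = z * val U.P p.L := by rw [h4, val_smul hL _ U.hP.1 p.L_mem_Icc]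
    rw [hφ₂, output_smul, hg] at hb
    simp only [v₂ _ p.L_mem_Icc]
    linear_combination hb

end Params

/-! ### Solvability of the resolvent equation with a bound -/

namespace Params

variable (p : Params)

/-- The first order system in components, tested against weak derivatives. -/
theorem exists_weak_bvp {z : ℂ} (hz : z.re = 0) : ∃ C, 0 ≤ C ∧
    ∀ (h₁ h₂ : L2I p.L) (r : ℂ × ℂ) (M : ℝ), √p.L * ‖h₁‖ ≤ M → √p.L * ‖h₂‖ ≤ M → ‖r‖ ≤ M →
    ∃ V P S₁ S₂ : L2I p.L, V ∈ p.H1star ∧ P ∈ p.H1star ∧ S₁ ∈ H1 p.L ∧ S₂ ∈ H1 p.L ∧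
      HasWeakDeriv V ((p.α₁⁻¹ : ℂ) • (S₁ + (p.γ : ℂ) • S₂)) ∧
      HasWeakDeriv P ((p.α₁⁻¹ : ℂ) • ((p.γ : ℂ) • S₁ + (p.α / p.β : ℂ) • S₂)) ∧
      HasWeakDeriv S₁ ((p.ρ * z ^ 2 : ℂ) • V - h₁) ∧
      HasWeakDeriv S₂ ((p.μ * z ^ 2 : ℂ) • P - h₂) ∧
      val S₁ p.L + p.l₁ * p.output (p.ker hz) * (z * val V p.L) = r.1 ∧
      val S₂ p.L + p.l₂ * p.output (p.ker hz) * (z * val P p.L) = r.2 ∧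
      ‖V‖ ≤ C * M ∧ ‖P‖ ≤ C * M ∧ ‖S₁‖ ≤ C * M ∧ ‖S₂‖ ≤ C * M ∧
      ‖val V p.L‖ ≤ C * M ∧ ‖val P p.L‖ ≤ C * M := by
  have hL := p.hL
  obtain ⟨C, hC, hbvp⟩ := p.exists_bvp hz (p.re_gain_mul_output_ker_pos hz p.hl₁)
    (p.re_gain_mul_output_ker_pos hz p.hl₂)
  -- One constant for both kinds of bound: `√L C` for the `L²` norms and `C` for the values at `L`.
  refine ⟨√p.L * C + C, by positivity, fun h₁ h₂ r M hM₁ hM₂ hr => ?_⟩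
  have hM : 0 ≤ M := (norm_nonneg _).trans hr
  obtain ⟨Y, hYc, hY0, hY0', hY, hb₁, hb₂, hYM⟩ := hbvp
    (fun x => (0, 0, -prim h₁ x, -prim h₂ x)) r M
    (by have := continuous_prim h₁; have := continuous_prim h₂; fun_prop)
    (by simp [prim_zero]) (fun x _ => by
      simp only [norm_prod_le_iff, norm_zero, norm_neg]
      exact ⟨hM, hM, (norm_prim_le hL _ _).trans hM₁, (norm_prim_le hL _ _).trans hM₂⟩) hr
  have cV : Continuous fun x => (Y x).1 := hYc.fst
  have cP : Continuous fun x => (Y x).2.1 := hYc.snd.fst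
  have cS₁ : Continuous fun x => (Y x).2.2.1 := hYc.snd.snd.fst
  have cS₂ : Continuous fun x => (Y x).2.2.2 := hYc.snd.snd.snd
  have hint : ∀ x, IntervalIntegrable (fun t => p.sysMat z (Y t)) volume 0 x := fun x =>
    ((p.sysMat z).continuous.comp hYc).intervalIntegrable 0 x
  -- The vector equation is split by commuting the coordinate projections with the integral; the
  -- loads enter only the two stress components.
  have iV : ∀ x, (Y x).1 = (Y 0).1 + 0 + ∫ t in (0 : ℝ)..x, (p.sysMat z (Y t)).1 := fun x => by
    have h := (ContinuousLinearMap.fst ℝ ℂ (ℂ × ℂ × ℂ)).intervalIntegral_comp_comm (hint x)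
    have h' := congrArg Prod.fst (hY x)
    simp only [ContinuousLinearMap.coe_fst'] at h
    rw [h]; exact h'
  have iP : ∀ x, (Y x).2.1 = (Y 0).2.1 + 0 + ∫ t in (0 : ℝ)..x, (p.sysMat z (Y t)).2.1 := fun x => by
    have h := ((ContinuousLinearMap.fst ℝ ℂ (ℂ × ℂ)).comp
      (ContinuousLinearMap.snd ℝ ℂ (ℂ × ℂ × ℂ))).intervalIntegral_comp_comm (hint x)
    have h' := congrArg (fun y : Phase => y.2.1) (hY x)
    simp only [ContinuousLinearMap.comp_apply, ContinuousLinearMap.coe_fst',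
      ContinuousLinearMap.coe_snd'] at h
    rw [h]; exact h'
  have iS₁ : ∀ x, (Y x).2.2.1 = (Y 0).2.2.1 + -prim h₁ x +
      ∫ t in (0 : ℝ)..x, (p.sysMat z (Y t)).2.2.1 := fun x => by
    have h := ((ContinuousLinearMap.fst ℝ ℂ ℂ).comp ((ContinuousLinearMap.snd ℝ ℂ (ℂ × ℂ)).comp
      (ContinuousLinearMap.snd ℝ ℂ (ℂ × ℂ × ℂ)))).intervalIntegral_comp_comm (hint x)
    have h' := congrArg (fun y : Phase => y.2.2.1) (hY x)
    simp only [ContinuousLinearMap.comp_apply, ContinuousLinearMap.coe_fst',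
      ContinuousLinearMap.coe_snd'] at h
    rw [h]; exact h'
  have iS₂ : ∀ x, (Y x).2.2.2 = (Y 0).2.2.2 + -prim h₂ x +
      ∫ t in (0 : ℝ)..x, (p.sysMat z (Y t)).2.2.2 := fun x => by
    have h := ((ContinuousLinearMap.snd ℝ ℂ ℂ).comp ((ContinuousLinearMap.snd ℝ ℂ (ℂ × ℂ)).comp
      (ContinuousLinearMap.snd ℝ ℂ (ℂ × ℂ × ℂ)))).intervalIntegral_comp_comm (hint x)
    have h' := congrArg (fun y : Phase => y.2.2.2) (hY x)
    simp only [ContinuousLinearMap.comp_apply,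
      ContinuousLinearMap.coe_snd'] at h
    rw [h]; exact h'
  set V := ofCont p.L _ cV with hV
  set P := ofCont p.L _ cP with hP
  set S₁ := ofCont p.L _ cS₁ with hS₁
  set S₂ := ofCont p.L _ cS₂ with hS₂
  have prim0 : ∀ x, prim (0 : L2I p.L) x = 0 := fun x => by
    have h := prim_add (0 : L2I p.L) 0 x
    rw [add_zero] at h
    exact left_eq_add.1 h
  have prim_neg' : ∀ (h : L2I p.L) x, prim (-h) x = -prim h x := fun h x => by
    have h1 := prim_add h (-h) x
    rw [add_neg_cancel, prim0] at h1
    exact (neg_eq_of_add_eq_zero_right h1.symm).symm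
  have aV := coeFn_ofCont (L := p.L) cV
  have aP := coeFn_ofCont (L := p.L) cP
  have aS₁ := coeFn_ofCont (L := p.L) cS₁
  have aS₂ := coeFn_ofCont (L := p.L) cS₂
  have wV : HasWeakDeriv V ((p.α₁⁻¹ : ℂ) • (S₁ + (p.γ : ℂ) • S₂)) := by
    rw [← add_zero ((p.α₁⁻¹ : ℂ) • (S₁ + (p.γ : ℂ) • S₂))]
    refine hasWeakDeriv_of_integral (Y 0).1 aV (w' := fun t => (p.sysMat z (Y t)).1) ?_
      fun x _ => by rw [iV x, prim0]
    filter_upwards [aS₁, aS₂, Lp.coeFn_smul (p.α₁⁻¹ : ℂ) (S₁ + (p.γ : ℂ) • S₂),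
      Lp.coeFn_add S₁ ((p.γ : ℂ) • S₂), Lp.coeFn_smul (p.γ : ℂ) S₂] with x e1 e2 e3 e4 e5
    rw [e3, Pi.smul_apply, e4, Pi.add_apply, e5, Pi.smul_apply, e1, e2, sysMat_apply]
    simp only [smul_eq_mul]; ring
  have wP : HasWeakDeriv P ((p.α₁⁻¹ : ℂ) • ((p.γ : ℂ) • S₁ + (p.α / p.β : ℂ) • S₂)) := by
    rw [← add_zero ((p.α₁⁻¹ : ℂ) • ((p.γ : ℂ) • S₁ + (p.α / p.β : ℂ) • S₂))]
    refine hasWeakDeriv_of_integral (Y 0).2.1 aP (w' := fun t => (p.sysMat z (Y t)).2.1) ?_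
      fun x _ => by rw [iP x, prim0]
    filter_upwards [aS₁, aS₂,
      Lp.coeFn_smul (p.α₁⁻¹ : ℂ) ((p.γ : ℂ) • S₁ + (p.α / p.β : ℂ) • S₂),
      Lp.coeFn_add ((p.γ : ℂ) • S₁) ((p.α / p.β : ℂ) • S₂), Lp.coeFn_smul (p.γ : ℂ) S₁,
      Lp.coeFn_smul (p.α / p.β : ℂ) S₂] with x e1 e2 e3 e4 e5 e6
    rw [e3, Pi.smul_apply, e4, Pi.add_apply, e5, e6, Pi.smul_apply, Pi.smul_apply, e1, e2,
      sysMat_apply]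
    simp only [smul_eq_mul]; ring
  have wS₁ : HasWeakDeriv S₁ ((p.ρ * z ^ 2 : ℂ) • V - h₁) := by
    rw [sub_eq_add_neg]
    refine hasWeakDeriv_of_integral (Y 0).2.2.1 aS₁ (w' := fun t => (p.sysMat z (Y t)).2.2.1) ?_
      fun x _ => by rw [iS₁ x, prim_neg']
    filter_upwards [aV, Lp.coeFn_smul (p.ρ * z ^ 2 : ℂ) V] with x e1 e2
    rw [e2, Pi.smul_apply, e1, sysMat_apply, smul_eq_mul]
  have wS₂ : HasWeakDeriv S₂ ((p.μ * z ^ 2 : ℂ) • P - h₂) := by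
    rw [sub_eq_add_neg]
    refine hasWeakDeriv_of_integral (Y 0).2.2.2 aS₂ (w' := fun t => (p.sysMat z (Y t)).2.2.2) ?_
      fun x _ => by rw [iS₂ x, prim_neg']
    filter_upwards [aP, Lp.coeFn_smul (p.μ * z ^ 2 : ℂ) P] with x e1 e2
    rw [e2, Pi.smul_apply, e1, sysMat_apply, smul_eq_mul]
  have bV : ∀ x ∈ Icc 0 p.L, ‖(Y x).1‖ ≤ C * M := fun x hx => (norm_fst_le _).trans (hYM x hx)
  have bYs : ∀ x ∈ Icc 0 p.L, ‖(Y x).2‖ ≤ C * M := fun x hx => (norm_snd_le _).trans (hYM x hx)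
  have bP : ∀ x ∈ Icc 0 p.L, ‖(Y x).2.1‖ ≤ C * M := fun x hx => (norm_fst_le _).trans (bYs x hx)
  have bS : ∀ x ∈ Icc 0 p.L, ‖(Y x).2.2‖ ≤ C * M := fun x hx => (norm_snd_le _).trans (bYs x hx)
  have bS₁ : ∀ x ∈ Icc 0 p.L, ‖(Y x).2.2.1‖ ≤ C * M := fun x hx =>
    (norm_fst_le _).trans (bS x hx)
  have bS₂ : ∀ x ∈ Icc 0 p.L, ‖(Y x).2.2.2‖ ≤ C * M := fun x hx =>
    (norm_snd_le _).trans (bS x hx)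
  have hCM : 0 ≤ C * M := by positivity
  have hLCM : 0 ≤ √p.L * C * M := by positivity
  have key : ∀ {w : ℝ → ℂ} (hw : Continuous w), (∀ x ∈ Icc 0 p.L, ‖w x‖ ≤ C * M) →
      ‖ofCont p.L w hw‖ ≤ (√p.L * C + C) * M := fun hw h =>
    (norm_ofCont_le hL hw hCM h).trans (by linarith)
  have vV : ∀ x ∈ Icc 0 p.L, val V x = (Y x).1 := fun x hx => val_eq hL (isContRep_ofCont cV) hx
  have vP : ∀ x ∈ Icc 0 p.L, val P x = (Y x).2.1 := fun x hx => val_eq hL (isContRep_ofCont cP) hx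
  have vS₁ : val S₁ p.L = (Y p.L).2.2.1 := val_eq hL (isContRep_ofCont cS₁) p.L_mem_Icc
  have vS₂ : val S₂ p.L = (Y p.L).2.2.2 := val_eq hL (isContRep_ofCont cS₂) p.L_mem_Icc
  refine ⟨V, P, S₁, S₂, ⟨⟨_, wV⟩, by rw [vV 0 p.zero_mem_Icc, hY0]⟩,
    ⟨⟨_, wP⟩, by rw [vP 0 p.zero_mem_Icc, hY0']⟩, ⟨_, wS₁⟩, ⟨_, wS₂⟩, wV, wP, wS₁, wS₂, ?_, ?_,
    key cV bV, key cP bP, key cS₁ bS₁, key cS₂ bS₂, ?_, ?_⟩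
  · rw [vS₁, vV _ p.L_mem_Icc]; exact hb₁
  · rw [vS₂, vP _ p.L_mem_Icc]; exact hb₂
  · rw [vV _ p.L_mem_Icc]; exact (bV _ p.L_mem_Icc).trans (by linarith)
  · rw [vP _ p.L_mem_Icc]; exact (bP _ p.L_mem_Icc).trans (by linarith)

/-- A weak solution of the first order system yields a solution of the resolvent equation. -/
theorem exists_state_of_weak_solution {z : ℂ} (hz : z.re = 0) (F : p.State) {V P S₁ S₂ : L2I p.L}
    (hV : V ∈ p.H1star) (hP : P ∈ p.H1star) (hS₁ : S₁ ∈ H1 p.L) (hS₂ : S₂ ∈ H1 p.L)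
    (wV : HasWeakDeriv V ((p.α₁⁻¹ : ℂ) • (S₁ + (p.γ : ℂ) • S₂)))
    (wP : HasWeakDeriv P ((p.α₁⁻¹ : ℂ) • ((p.γ : ℂ) • S₁ + (p.α / p.β : ℂ) • S₂)))
    (wS₁ : HasWeakDeriv S₁ ((p.ρ * z ^ 2 : ℂ) • V - (p.ρ : ℂ) • (z • F.V + F.f)))
    (wS₂ : HasWeakDeriv S₂ ((p.μ * z ^ 2 : ℂ) • P - (p.μ : ℂ) • (z • F.P + F.g)))
    (b₁ : val S₁ p.L + p.l₁ * p.output (p.ker hz) * (z * val V p.L) =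
      -(p.l₁ : ℂ) * p.output (p.divSym hz F.φ₁) + p.l₁ * p.output (p.ker hz) * val F.V p.L)
    (b₂ : val S₂ p.L + p.l₂ * p.output (p.ker hz) * (z * val P p.L) =
      -(p.l₂ : ℂ) * p.output (p.divSym hz F.φ₂) + p.l₂ * p.output (p.ker hz) * val F.P p.L) :
    ∃ (U : p.State) (hU : p.InDomain U), z • U - p.act U hU = F ∧
      U.f = z • V - F.V ∧ U.g = z • P - F.P ∧
      U.Vx = (p.α₁⁻¹ : ℂ) • (S₁ + (p.γ : ℂ) • S₂) ∧
      U.Px = (p.α₁⁻¹ : ℂ) • ((p.γ : ℂ) • S₁ + (p.α / p.β : ℂ) • S₂) ∧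
      U.φ₁ = p.diffSol hz F.φ₁ (z * val V p.L - val F.V p.L) ∧
      U.φ₂ = p.diffSol hz F.φ₂ (z * val P p.L - val F.P p.L) := by
  have hL := p.hL
  have hρ : (p.ρ : ℂ) ≠ 0 := by exact_mod_cast p.hρ.ne'
  have hμ : (p.μ : ℂ) ≠ 0 := by exact_mod_cast p.hμ.ne'
  have hα₁ : (p.α₁ : ℂ) ≠ 0 := by exact_mod_cast p.hα₁.ne'
  have hβ : (p.β : ℂ) ≠ 0 := by exact_mod_cast p.hβ.ne'
  have hα : (p.α : ℂ) = p.α₁ + p.γ ^ 2 * p.β := by rw [α]; push_cast; ring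
  have eVx := wd_eq wV
  have ePx := wd_eq wP
  have hf : z • V - F.V ∈ p.H1star := sub_mem (Submodule.smul_mem _ _ hV) F.hV
  have hg : z • P - F.P ∈ p.H1star := sub_mem (Submodule.smul_mem _ _ hP) F.hP
  have vf : val (z • V - F.V) p.L = z * val V p.L - val F.V p.L := by
    rw [val_sub hL (Submodule.smul_mem _ _ hV.1) F.hV.1 p.L_mem_Icc, val_smul hL _ hV.1 p.L_mem_Icc]
  have vg : val (z • P - F.P) p.L = z * val P p.L - val F.P p.L := by
    rw [val_sub hL (Submodule.smul_mem _ _ hP.1) F.hP.1 p.L_mem_Icc, val_smul hL _ hP.1 p.L_mem_Icc]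
  set φ₁ := p.diffSol hz F.φ₁ (val (z • V - F.V) p.L) with hφ₁
  set φ₂ := p.diffSol hz F.φ₂ (val (z • P - F.P) p.L) with hφ₂
  set U : p.State := State.mk V hV (z • V - F.V) φ₁ P hP (z • P - F.P) φ₂ with hUdef
  have UVx : U.Vx = (p.α₁⁻¹ : ℂ) • (S₁ + (p.γ : ℂ) • S₂) := eVx
  have UPx : U.Px = (p.α₁⁻¹ : ℂ) • ((p.γ : ℂ) • S₁ + (p.α / p.β : ℂ) • S₂) := ePx
  have mγ₂ : (p.γ : ℂ) • S₂ ∈ H1 p.L := Submodule.smul_mem _ _ hS₂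
  have mγ₁ : (p.γ : ℂ) • S₁ ∈ H1 p.L := Submodule.smul_mem _ _ hS₁
  have mα₂ : (p.α / p.β : ℂ) • S₂ ∈ H1 p.L := Submodule.smul_mem _ _ hS₂
  have mVx : U.Vx ∈ H1 p.L := by
    rw [UVx]; exact Submodule.smul_mem _ _ (add_mem hS₁ mγ₂)
  have mPx : U.Px ∈ H1 p.L := by
    rw [UPx]; exact Submodule.smul_mem _ _ (add_mem mγ₁ mα₂)
  have valVx : val U.Vx p.L = (p.α₁⁻¹ : ℂ) * (val S₁ p.L + p.γ * val S₂ p.L) := by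
    rw [UVx, val_smul hL _ (add_mem hS₁ mγ₂) p.L_mem_Icc, val_add hL hS₁ mγ₂ p.L_mem_Icc,
      val_smul hL _ hS₂ p.L_mem_Icc]
  have valPx : val U.Px p.L =
      (p.α₁⁻¹ : ℂ) * (p.γ * val S₁ p.L + p.α / p.β * val S₂ p.L) := by
    rw [UPx, val_smul hL _ (add_mem mγ₁ mα₂) p.L_mem_Icc, val_add hL mγ₁ mα₂ p.L_mem_Icc,
      val_smul hL _ hS₁ p.L_mem_Icc, val_smul hL _ hS₂ p.L_mem_Icc]
  have wdVx : wd U.Vx = (p.α₁⁻¹ : ℂ) • (((p.ρ * z ^ 2 : ℂ) • V - (p.ρ : ℂ) • (z • F.V + F.f))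
      + (p.γ : ℂ) • ((p.μ * z ^ 2 : ℂ) • P - (p.μ : ℂ) • (z • F.P + F.g))) := by
    rw [UVx]; exact wd_eq ((wS₁.add (wS₂.smul _)).smul _)
  have wdPx : wd U.Px = (p.α₁⁻¹ : ℂ) • ((p.γ : ℂ) • ((p.ρ * z ^ 2 : ℂ) • V
      - (p.ρ : ℂ) • (z • F.V + F.f))
      + (p.α / p.β : ℂ) • ((p.μ * z ^ 2 : ℂ) • P - (p.μ : ℂ) • (z • F.P + F.g))) := by
    rw [UPx]; exact wd_eq (((wS₁.smul _).add (wS₂.smul _)).smul _)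
  have dφ₁ := p.diffusive_diffSol hz F.φ₁ (val (z • V - F.V) p.L)
  have dφ₂ := p.diffusive_diffSol hz F.φ₂ (val (z • P - F.P) p.L)
  have o₁ := p.output_diffSol hz F.φ₁ (val (z • V - F.V) p.L)
  have o₂ := p.output_diffSol hz F.φ₂ (val (z • P - F.P) p.L)
  have hU : p.InDomain U :=
    { V_mem := ⟨hV.1, mVx⟩
      P_mem := ⟨hP.1, mPx⟩
      f_mem := hf
      g_mem := hg
      abs_φ₁ := p.absMul_diffSol hz _ _
      abs_φ₂ := p.absMul_diffSol hz _ _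
      diff_φ₁ := (memLp_congr_ae dφ₁).2 (Lp.memLp _)
      diff_φ₂ := (memLp_congr_ae dφ₂).2 (Lp.memLp _)
      -- Inverting the stress relations uses `α - γ²β = α₁`. The left side is then `S₁(L)`, and the
      -- output of `φ₁` splits into the `F.φ₁` part and `f(L)` times the output of `ker`, which is
      -- `b₁` up to the factor `α₁`.
      bdry_V := by
        change _ = -(p.l₁ : ℂ) * p.output φ₁
        rw [valVx, valPx, hα, hφ₁, o₁, vf]
        field_simp
        linear_combination (p.α₁ : ℂ) * b₁
      bdry_P := by
        change _ = -(p.l₂ : ℂ) * p.output φ₂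
        rw [valVx, valPx, hα, hφ₂, o₂, vg]
        field_simp
        linear_combination (p.α₁ : ℂ) * b₂ }
  have hact₁ : hU.diff_φ₁.toLp _ = z • φ₁ - F.φ₁ := Lp.ext ((MemLp.coeFn_toLp hU.diff_φ₁).trans dφ₁)
  have hact₂ : hU.diff_φ₂.toLp _ = z • φ₂ - F.φ₂ := Lp.ext ((MemLp.coeFn_toLp hU.diff_φ₂).trans dφ₂)
  refine ⟨U, hU, sub_eq_iff_eq_add.2 ?_, rfl, rfl, UVx, UPx, by rw [← vf]; rfl, by rw [← vg]; rfl⟩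
  refine State.ext ?_ ?_ ?_ ?_ ?_ ?_
  · change z • V = F.V + (z • V - F.V)
    abel
  · change z • (z • V - F.V) = F.f +
      (((p.α / p.ρ : ℝ) : ℂ) • wd U.Vx - ((p.γ * p.β / p.ρ : ℝ) : ℂ) • wd U.Px)
    rw [wdVx, wdPx]
    push_cast
    rw [hα]
    match_scalars <;> field_simp <;> ring
  · change z • φ₁ = F.φ₁ + hU.diff_φ₁.toLp _
    rw [hact₁]; abel
  · change z • P = F.P + (z • P - F.P)
    abel
  · change z • (z • P - F.P) = F.g +
      (-((p.γ * p.β / p.μ : ℝ) : ℂ) • wd U.Vx + ((p.β / p.μ : ℝ) : ℂ) • wd U.Px)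
    rw [wdVx, wdPx]
    push_cast
    rw [hα]
    match_scalars <;> field_simp <;> ring
  · change z • φ₂ = F.φ₂ + hU.diff_φ₂.toLp _
    rw [hact₂]; abel

/-- The data of the resolvent equation are bounded by the energy norm. -/
theorem exists_norm_data_le : ∃ T, 0 ≤ T ∧ ∀ F : p.State,
    (‖F.V‖ ≤ T * ‖F‖ ∧ ‖F.f‖ ≤ T * ‖F‖ ∧ ‖F.φ₁‖ ≤ T * ‖F‖ ∧ ‖val F.V p.L‖ ≤ T * ‖F‖) ∧
    ‖F.P‖ ≤ T * ‖F‖ ∧ ‖F.g‖ ≤ T * ‖F‖ ∧ ‖F.φ₂‖ ≤ T * ‖F‖ ∧ ‖val F.P p.L‖ ≤ T * ‖F‖ := by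
  have hL := p.hL
  obtain ⟨K, hK, hcomp⟩ := p.exists_norm_components_le
  have t2 : 0 ≤ p.L * K := by positivity
  have t3 : 0 ≤ √p.L * K := by positivity
  refine ⟨K + p.L * K + √p.L * K, by positivity, fun F => ?_⟩
  obtain ⟨cf, cg, cVx, cPx, cφ₁, cφ₂⟩ := hcomp F
  have toT : ∀ {x c : ℝ}, x ≤ c * ‖F‖ → c ≤ K + p.L * K + √p.L * K →
      x ≤ (K + p.L * K + √p.L * K) * ‖F‖ := fun h h' =>
    h.trans (mul_le_mul_of_nonneg_right h' (norm_nonneg _))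
  have hstar : ∀ {u : L2I p.L}, u ∈ p.H1star → ‖wd u‖ ≤ K * ‖F‖ →
      ‖u‖ ≤ p.L * K * ‖F‖ ∧ ‖val u p.L‖ ≤ √p.L * K * ‖F‖ := fun hu h =>
    ⟨(norm_le_wd hL hu.1 hu.2).trans (by
      rw [mul_assoc]; exact mul_le_mul_of_nonneg_left h hL.le),
    (norm_val_le hL hu.1 hu.2 p.L_mem_Icc).trans (by
      rw [mul_assoc]; exact mul_le_mul_of_nonneg_left h (Real.sqrt_nonneg _))⟩
  have sV := hstar F.hV cVx
  have sP := hstar F.hP cPx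
  exact ⟨⟨toT sV.1 (by linarith), toT cf (by linarith), toT cφ₁ (by linarith),
    toT sV.2 (by linarith)⟩, toT sP.1 (by linarith), toT cg (by linarith), toT cφ₂ (by linarith),
    toT sP.2 (by linarith)⟩

/-- `z - A` is onto for purely imaginary `z`, with a bound on the solution. -/
theorem exists_resolvent_solution {z : ℂ} (hz : z.re = 0) : ∃ C, 0 ≤ C ∧ ∀ F : p.State,
    ∃ (U : p.State) (hU : p.InDomain U), z • U - p.act U hU = F ∧ ‖U‖ ≤ C * ‖F‖ := by
  have hL := p.hL
  have hρ' := p.hρ; have hμ' := p.hμ; have hl₁' := p.hl₁; have hl₂' := p.hl₂; have hκ := p.κ_pos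
  have hη := p.hη
  obtain ⟨T, hT0, hdata⟩ := p.exists_norm_data_le
  obtain ⟨K', hK', hnorm⟩ := p.exists_norm_le_components
  obtain ⟨C, hC, hbvp⟩ := p.exists_weak_bvp hz
  set k := p.output (p.ker hz) with hk
  -- the size of the data of the boundary value problem relative to `‖F‖`
  set m := √p.L * (p.ρ * (‖z‖ * T + T)) + √p.L * (p.μ * (‖z‖ * T + T))
    + (p.l₁ * (p.κ * (‖p.ker hz‖ * T)) + p.l₁ * ‖k‖ * T)
    + (p.l₂ * (p.κ * (‖p.ker hz‖ * T)) + p.l₂ * ‖k‖ * T) with hm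
  have m1 : 0 ≤ √p.L * (p.ρ * (‖z‖ * T + T)) := by positivity
  have m2 : 0 ≤ √p.L * (p.μ * (‖z‖ * T + T)) := by positivity
  have m3 : 0 ≤ p.l₁ * (p.κ * (‖p.ker hz‖ * T)) + p.l₁ * ‖k‖ * T := by positivity
  have m4 : 0 ≤ p.l₂ * (p.κ * (‖p.ker hz‖ * T)) + p.l₂ * ‖k‖ * T := by positivity
  have hm0 : 0 ≤ m := by positivity
  -- Bounds expressions `z u - v` with `u` from the boundary value problem and `v` from the data:
  -- the velocities `f`, `g` and their values at `L`.
  set Q := ‖z‖ * (C * m) + T with hQ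
  refine ⟨K' * (Q + Q + ‖(p.α₁⁻¹ : ℂ)‖ * (C * m + ‖(p.γ : ℂ)‖ * (C * m))
    + ‖(p.α₁⁻¹ : ℂ)‖ * (‖(p.γ : ℂ)‖ * (C * m) + ‖(p.α / p.β : ℂ)‖ * (C * m))
    + (p.η⁻¹ * T + Q * ‖p.ker hz‖) + (p.η⁻¹ * T + Q * ‖p.ker hz‖)), by positivity, fun F => ?_⟩
  have hF0 := norm_nonneg F
  obtain ⟨⟨tV, tf, tφ₁, tVL⟩, tP, tg, tφ₂, tPL⟩ := hdata F
  have hload : ∀ (c : ℝ) (u v : L2I p.L), 0 < c → ‖u‖ ≤ T * ‖F‖ → ‖v‖ ≤ T * ‖F‖ →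
      √p.L * ‖(c : ℂ) • (z • u + v)‖ ≤ √p.L * (c * (‖z‖ * T + T)) * ‖F‖ := by
    intro c u v hc hu hv
    have h1 : ‖z • u + v‖ ≤ (‖z‖ * T + T) * ‖F‖ := by
      refine (norm_add_le _ _).trans ?_
      rw [norm_smul, add_mul, mul_assoc]
      exact add_le_add (mul_le_mul_of_nonneg_left hu (norm_nonneg _)) hv
    rw [norm_smul, Complex.norm_real, Real.norm_of_nonneg hc.le, mul_assoc, mul_assoc]
    gcongr
  have hbdry : ∀ (l : ℝ) (φ : L2R) (v : ℂ), 0 < l → ‖φ‖ ≤ T * ‖F‖ → ‖v‖ ≤ T * ‖F‖ →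
      ‖-(l : ℂ) * p.output (p.divSym hz φ) + l * k * v‖ ≤
        (l * (p.κ * (‖p.ker hz‖ * T)) + l * ‖k‖ * T) * ‖F‖ := by
    intro l φ v hl hφ hv
    refine (norm_add_le _ _).trans ?_
    rw [norm_mul, norm_mul, norm_mul, norm_neg, Complex.norm_real, Real.norm_of_nonneg hl.le]
    have h1 : ‖p.output (p.divSym hz φ)‖ ≤ p.κ * (‖p.ker hz‖ * (T * ‖F‖)) :=
      (p.norm_output_divSym_le hz φ).trans (by gcongr)
    calc _ ≤ l * (p.κ * (‖p.ker hz‖ * (T * ‖F‖))) + l * ‖k‖ * (T * ‖F‖) := by gcongr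
      _ = _ := by ring
  have hmle : ∀ {x c : ℝ}, x ≤ c * ‖F‖ → c ≤ m → x ≤ m * ‖F‖ := fun h h' =>
    h.trans (mul_le_mul_of_nonneg_right h' hF0)
  obtain ⟨V, P, S₁, S₂, hV, hP, hS₁, hS₂, wV, wP, wS₁, wS₂, b₁, b₂, nV, nP, nS₁, nS₂, nVL, nPL⟩ :=
    hbvp ((p.ρ : ℂ) • (z • F.V + F.f)) ((p.μ : ℂ) • (z • F.P + F.g))
      (-(p.l₁ : ℂ) * p.output (p.divSym hz F.φ₁) + p.l₁ * k * val F.V p.L,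
        -(p.l₂ : ℂ) * p.output (p.divSym hz F.φ₂) + p.l₂ * k * val F.P p.L) (m * ‖F‖)
      (hmle (hload _ _ _ p.hρ tV tf) (by linarith)) (hmle (hload _ _ _ p.hμ tP tg) (by linarith))
      (norm_prod_le_iff.2 ⟨hmle (hbdry _ _ _ p.hl₁ tφ₁ tVL) (by linarith),
        hmle (hbdry _ _ _ p.hl₂ tφ₂ tPL) (by linarith)⟩)
  simp only at b₁ b₂
  obtain ⟨U, hU, hUF, Uf, Ug, UVx, UPx, Uφ₁, Uφ₂⟩ := p.exists_state_of_weak_solution hz F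
    hV hP hS₁ hS₂ wV wP wS₁ wS₂ b₁ b₂
  refine ⟨U, hU, hUF, ?_⟩
  refine (hnorm U).trans ?_
  rw [mul_assoc]
  refine mul_le_mul_of_nonneg_left ?_ hK'
  have qsub : ∀ {E : Type} [NormedAddCommGroup E] [NormedSpace ℂ E] (u v : E),
      ‖u‖ ≤ C * (m * ‖F‖) → ‖v‖ ≤ T * ‖F‖ → ‖z • u - v‖ ≤ Q * ‖F‖ := by
    intro E _ _ u v hu hv
    refine (norm_sub_le _ _).trans ?_
    rw [norm_smul]
    calc _ ≤ ‖z‖ * (C * (m * ‖F‖)) + T * ‖F‖ := by gcongr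
      _ = _ := by ring
  have qφ : ∀ (φ : L2R) (b : ℂ), ‖φ‖ ≤ T * ‖F‖ → ‖b‖ ≤ Q * ‖F‖ →
      ‖p.diffSol hz φ b‖ ≤ (p.η⁻¹ * T + Q * ‖p.ker hz‖) * ‖F‖ := by
    intro φ b hφ hb
    refine (norm_add_le _ _).trans ?_
    rw [norm_smul]
    calc _ ≤ p.η⁻¹ * (T * ‖F‖) + Q * ‖F‖ * ‖p.ker hz‖ := by
          gcongr
          exact (p.norm_divSym_le hz φ).trans (by gcongr)
      _ = _ := by ring
  have uf : ‖U.f‖ ≤ Q * ‖F‖ := by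
    rw [Uf]; exact qsub _ _ nV tV
  have ug : ‖U.g‖ ≤ Q * ‖F‖ := by
    rw [Ug]; exact qsub _ _ nP tP
  have uφ₁ : ‖U.φ₁‖ ≤ (p.η⁻¹ * T + Q * ‖p.ker hz‖) * ‖F‖ := by
    rw [Uφ₁]; exact qφ F.φ₁ _ tφ₁ (qsub (E := ℂ) _ _ nVL tVL)
  have uφ₂ : ‖U.φ₂‖ ≤ (p.η⁻¹ * T + Q * ‖p.ker hz‖) * ‖F‖ := by
    rw [Uφ₂]; exact qφ F.φ₂ _ tφ₂ (qsub (E := ℂ) _ _ nPL tPL)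
  have uVx : ‖U.Vx‖ ≤ ‖(p.α₁⁻¹ : ℂ)‖ * (C * m + ‖(p.γ : ℂ)‖ * (C * m)) * ‖F‖ := by
    rw [UVx, norm_smul, mul_assoc]
    refine mul_le_mul_of_nonneg_left ((norm_add_le _ _).trans ?_) (norm_nonneg _)
    rw [norm_smul]
    calc _ ≤ C * (m * ‖F‖) + ‖(p.γ : ℂ)‖ * (C * (m * ‖F‖)) := by gcongr
      _ = _ := by ring
  have uPx : ‖U.Px‖ ≤ ‖(p.α₁⁻¹ : ℂ)‖ *
      (‖(p.γ : ℂ)‖ * (C * m) + ‖(p.α / p.β : ℂ)‖ * (C * m)) * ‖F‖ := by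
    rw [UPx, norm_smul, mul_assoc]
    refine mul_le_mul_of_nonneg_left ((norm_add_le _ _).trans ?_) (norm_nonneg _)
    rw [norm_smul, norm_smul]
    calc _ ≤ ‖(p.γ : ℂ)‖ * (C * (m * ‖F‖)) + ‖(p.α / p.β : ℂ)‖ * (C * (m * ‖F‖)) := by gcongr
      _ = _ := by ring
  simp only [add_mul _ _ ‖F‖] at uf ug uφ₁ uφ₂ uVx uPx ⊢
  linarith

end Params

/-! ### Conclusion from injectivity and the bound -/

/-- A point belongs to the resolvent set as soon as `z - A` is injective and has a bounded right
inverse. -/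
theorem mem_resolventSet_of_bound {E : Type*} [NormedAddCommGroup E] [NormedSpace ℂ E]
    {A : E →ₗ.[ℂ] E} {z : ℂ} (hinj : ∀ x : A.domain, z • (x : E) - A x = 0 → x = 0) {C : ℝ}
    (hsurj : ∀ y, ∃ x : A.domain, z • (x : E) - A x = y ∧ ‖(x : E)‖ ≤ C * ‖y‖) :
    z ∈ resolventSet A := by
  let T : A.domain →ₗ[ℂ] E := z • A.domain.subtype - A.toFun
  have hT : ∀ x, T x = z • (x : E) - A x := fun _ => rfl
  have hinj' : Function.Injective T := (injective_iff_map_eq_zero T).2 hinj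
  let e := LinearEquiv.ofBijective T ⟨hinj', fun y => (hsurj y).imp fun _ h => h.1⟩
  have he : ∀ x, e x = z • (x : E) - A x := fun _ => rfl
  let R : E →L[ℂ] E := (A.domain.subtype ∘ₗ e.symm.toLinearMap).mkContinuous C fun y => by
    obtain ⟨x, hx, hxn⟩ := hsurj y
    -- Injectivity identifies the bounded preimage with the value of the algebraic inverse, so
    -- linearity and boundedness hold for the same map.
    have : e.symm y = x := by rw [LinearEquiv.symm_apply_eq, he, hx]
    simpa [this] using hxn
  have hR : ∀ y, R y = (e.symm y : E) := fun _ => rfl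
  refine ⟨R, fun x => ?_, fun y => ⟨e.symm y, rfl, ?_⟩⟩
  · rw [hR, ← he, e.symm_apply_apply]
  · rw [← he, e.apply_symm_apply]

end

end Piezo

theorem mainTheorem6 (p : Piezo.Params) :
    {z : ℂ | z.re = 0} ⊆ Piezo.resolventSet p.generator := by
  intro z hz
  obtain ⟨C, -, hC⟩ := p.exists_resolvent_solution hz
  refine Piezo.mem_resolventSet_of_bound (C := C) (fun x hx => ?_) fun y => ?_
  · exact Subtype.ext (p.eq_zero_of_smul_eq_act hz x.2 (sub_eq_zero.1 hx))
  · obtain ⟨U, hU, h1, h2⟩ := hC y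
    exact ⟨⟨U, hU⟩, h1, h2⟩
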